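/- Let $L,\rho,\mu,\alpha_1,\beta,\xi_1,\xi_2,m_1,m_2>0$ and $\gamma\in\mathbb R$, and put $\alpha=\alpha_1+\gamma^2\beta$. Consider the piezoelectric beam system with magnetic effect and tip masses, on $0<x<L$, $t\ge 0$, $$\rho V_{tt}-\alpha V_{xx}+\gamma\beta P_{xx}=0,\qquad \mu P_{tt}-\beta P_{xx}+\gamma\beta V_{xx}=0,$$ $$V(0,t)=0,\quad \alpha V_x(L,t)-\gamma\beta P_x(L,t)+\xi_1u(t)+m_1u_t(t)=0,\qquad P(0,t)=0,\quad \beta P_x(L,t)-\gamma\beta V_x(L,t)+\xi_2\eta(t)+m_2\eta_t(t)=0,$$ where $u(t)=V_t(L,t)$ and $\eta(t)=P_t(L,t)$, with initial condition $(V,V_t,P,P_t,u,\eta)(0)=U_0$. Let $H^1_*(0,L)=\{f\in H^1(0,L): f(0)=0\}$ (complex-valued functions) and let $$\mathcal H=H^1_*(0,L)\times L^2(0,L)\times H^1_*(0,L)\times L^2(0,L)\times\mathbb C\times\mathbb C$$ carry the inner product, for $U_i=(V_i,\Phi_i,P_i,\Theta_i,u_i,\eta_i)$, $$\langle U_1,U_2\rangle_{\mathcal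 H}=\int_0^L\big[\rho\Phi_1\overline{\Phi_2}+\mu\Theta_1\overline{\Theta_2}+\alpha_1V_{1,x}\overline{V_{2,x}}+\beta(\gamma V_{1,x}-P_{1,x})\overline{(\gamma V_{2,x}-P_{2,x})}\big]dx+m_1u_1\overline{u_2}+m_2\eta_1\overline{\eta_2}.$$ Let $\mathcal A$ be the operator in $\mathcal H$ with domain $$\mathcal D(\mathcal A)=\{U=(V,\Phi,P,\Theta,u,\eta)\in\mathcal H:\ \Phi,\Theta\in H^1_*(0,L),\ V,P\in H^2(0,L),\ \Phi(L)=u,\ \Theta(L)=\eta\}$$ given by $$\mathcal AU=\Big(\Phi,\ \tfrac{\alpha V_{xx}-\gamma\beta P_{xx}}{\rho},\ \Theta,\ \tfrac{\beta P_{xx}-\gamma\beta V_{xx}}{\mu},\ \tfrac{-\alpha V_x(L)+\gamma\beta P_x(L)-\xi_1u}{m_1},\ \tfrac{\gamma\beta V_x(L)-\beta P_x(L)-\xi_2\eta}{m_2}\Big).$$ Then: 1. A curve $U=(V,\Phi,P,\Theta,u,\eta)\in C^1([0,\infty);\mathcal H)$ with $V(t),P(t)\in H^2(0,L)$ for all $t\ge0$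 satisfies $\Phi=V_t$, $\Theta=P_t$ and the beam system above, with its boundary and initial conditions (the two wave equations holding in $L^2(0,L)$ for every $t\ge0$), if and only if it belongs to $C([0,\infty);\mathcal D(\mathcal A))\cap C^1([0,\infty);\mathcal H)$, where $\mathcal D(\mathcal A)$ carries the graph norm, and solves the Cauchy problem $U_t=\mathcal AU$ for $t\ge0$, $U(0)=U_0$. 2. $\mathcal A$ is the infinitesimal generator of a $C_0$-semigroup of contractions $(\mathcal S_{\mathcal A}(t))_{t\ge0}$ on $\mathcal H$. 3. For every $U_0\in\mathcal D(\mathcal A)$, $U(t)=\mathcal S_{\mathcal A}(t)U_0$ is the unique solution of $U_t=\mathcal AU$, $U(0)=U_0$, in the class $C([0,\infty);\mathcal D(\mathcal A))\cap C^1([0,\infty);\mathcal H)$. -/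

import Mathlib

open MeasureTheory Set Filter
open scoped Topology NNReal ContDiff ComplexConjugate

noncomputable section

namespace PiezoBeam

/-! ### Sobolev spaces on the interval `(0, L)` -/

/-- The complex Lebesgue space `L²(0, L)`. -/
abbrev L2 (L : ℝ) : Type := Lp ℂ 2 (volume.restrict (Ioo (0 : ℝ) L))

/-- `g` is the weak derivative of `f` on `(0, L)`:
`∫ φ' f = - ∫ φ g` for all test functions `φ ∈ C_c^∞(0, L)`. -/
def IsWeakDeriv (L : ℝ) (f g : L2 L) : Prop :=
  ∀ φ : ℝ → ℝ, ContDiff ℝ ∞ φ → HasCompactSupport φ → tsupport φ ⊆ Ioo 0 L →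
    ∫ x in Ioo 0 L, deriv φ x • f x = - ∫ x in Ioo 0 L, φ x • g x

lemma integrableOn_L2 {L : ℝ} (f : L2 L) : IntegrableOn f (Ioo 0 L) :=
  (Lp.memLp f).integrable one_le_two

lemma integrable_smul {L : ℝ} {f : ℝ → ℂ} (hf : IntegrableOn f (Ioo 0 L)) {φ : ℝ → ℝ}
    (hc : Continuous φ) (hs : HasCompactSupport φ) :
    IntegrableOn (fun x => φ x • f x) (Ioo 0 L) := by
  obtain ⟨C, hC⟩ := hc.bounded_above_of_compact_support hs
  exact Integrable.bdd_smul hf C hc.aestronglyMeasurable (Eventually.of_forall hC)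

lemma ae_zero_of_test {L : ℝ} {h : ℝ → ℂ} (hh : IntegrableOn h (Ioo 0 L))
    (H : ∀ φ : ℝ → ℝ, ContDiff ℝ ∞ φ → HasCompactSupport φ → tsupport φ ⊆ Ioo 0 L →
      ∫ x in Ioo 0 L, φ x • h x = 0) : h =ᵐ[volume.restrict (Ioo 0 L)] 0 := by
  have := isOpen_Ioo.ae_eq_zero_of_integral_contDiff_smul_eq_zero (μ := volume)
    (hh.locallyIntegrableOn) (fun φ h1 h2 h3 => by
      rw [← H φ h1 h2 h3, setIntegral_eq_integral_of_forall_compl_eq_zero]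
      intro x hx
      rw [image_eq_zero_of_notMem_tsupport (fun hx' => hx (h3 hx')), zero_smul])
  exact (ae_restrict_iff' measurableSet_Ioo).2 this

lemma IsWeakDeriv.unique {L : ℝ} {f g g' : L2 L} (h : IsWeakDeriv L f g)
    (h' : IsWeakDeriv L f g') : g = g' := by
  have key := ae_zero_of_test ((integrableOn_L2 g).sub (integrableOn_L2 g'))
    (fun φ h1 h2 h3 => by
      have e := (h φ h1 h2 h3).symm.trans (h' φ h1 h2 h3)
      simp only [Pi.sub_apply, smul_sub]
      rw [integral_sub (integrable_smul (integrableOn_L2 g) h1.continuous h2)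
        (integrable_smul (integrableOn_L2 g') h1.continuous h2), sub_eq_zero]
      exact neg_injective e)
  refine Lp.ext ?_
  filter_upwards [key] with x hx
  exact sub_eq_zero.1 hx

lemma IsWeakDeriv.add {L : ℝ} {f g f' g' : L2 L} (h : IsWeakDeriv L f g)
    (h' : IsWeakDeriv L f' g') : IsWeakDeriv L (f + f') (g + g') := by
  intro φ h1 h2 h3
  have hd : Continuous (deriv φ) := h1.continuous_deriv (by simp)
  have e1 : ∫ x in Ioo 0 L, deriv φ x • (f + f' : L2 L) x
      = ∫ x in Ioo 0 L, (deriv φ x • f x + deriv φ x • f' x) := by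
    refine integral_congr_ae ?_
    filter_upwards [Lp.coeFn_add f f'] with x hx
    rw [hx, Pi.add_apply, smul_add]
  have e2 : ∫ x in Ioo 0 L, φ x • (g + g' : L2 L) x
      = ∫ x in Ioo 0 L, (φ x • g x + φ x • g' x) := by
    refine integral_congr_ae ?_
    filter_upwards [Lp.coeFn_add g g'] with x hx
    rw [hx, Pi.add_apply, smul_add]
  rw [e1, e2, integral_add (integrable_smul (integrableOn_L2 f) hd h2.deriv)
    (integrable_smul (integrableOn_L2 f') hd h2.deriv),
    integral_add (integrable_smul (integrableOn_L2 g) h1.continuous h2)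
    (integrable_smul (integrableOn_L2 g') h1.continuous h2), h φ h1 h2 h3, h' φ h1 h2 h3, neg_add]

lemma IsWeakDeriv.smul {L : ℝ} {f g : L2 L} (c : ℂ) (h : IsWeakDeriv L f g) :
    IsWeakDeriv L (c • f) (c • g) := by
  intro φ h1 h2 h3
  have e1 : ∫ x in Ioo 0 L, deriv φ x • (c • f : L2 L) x
      = ∫ x in Ioo 0 L, c • (deriv φ x • f x) := by
    refine integral_congr_ae ?_
    filter_upwards [Lp.coeFn_smul c f] with x hx
    rw [hx, Pi.smul_apply, smul_comm]
  have e2 : ∫ x in Ioo 0 L, φ x • (c • g : L2 L) x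
      = ∫ x in Ioo 0 L, c • (φ x • g x) := by
    refine integral_congr_ae ?_
    filter_upwards [Lp.coeFn_smul c g] with x hx
    rw [hx, Pi.smul_apply, smul_comm]
  rw [e1, e2, integral_smul, integral_smul, h φ h1 h2 h3, smul_neg]

lemma IsWeakDeriv.zero {L : ℝ} : IsWeakDeriv L 0 0 := by
  have z (φ : ℝ → ℝ) : ∫ x in Ioo 0 L, φ x • (0 : L2 L) x = 0 := by
    refine integral_eq_zero_of_ae ?_
    filter_upwards [Lp.coeFn_zero ℂ 2 (volume.restrict (Ioo (0 : ℝ) L))] with x hx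
    rw [hx]; simp
  intro φ _ _ _
  rw [z, z, neg_zero]

/-- Integration by parts against a primitive. -/
lemma integral_deriv_smul_primitive {L : ℝ} {g : ℝ → ℂ}
    (hg : IntegrableOn g (Ioo 0 L)) {φ : ℝ → ℝ} (h1 : ContDiff ℝ ∞ φ)
    (h2 : HasCompactSupport φ) (h3 : tsupport φ ⊆ Ioo 0 L) :
    ∫ x in Ioo 0 L, deriv φ x • (∫ t in (0 : ℝ)..x, g t) = - ∫ x in Ioo 0 L, φ x • g x := by
  have hd : Continuous (deriv φ) := h1.continuous_deriv (by simp)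
  set μ := volume.restrict (Ioo (0 : ℝ) L) with hμ
  let F : ℝ → ℝ → ℂ := fun x t => (Ioc 0 x).indicator (fun t => deriv φ x • g t) t
  have hF : ∀ x t, F x t = if 0 < t ∧ t ≤ x then deriv φ x • g t else 0 := by
    intro x t; simp only [F, indicator, mem_Ioc]
  have hint : Integrable (Function.uncurry F) (μ.prod μ) := by
    have hA : Integrable (fun z : ℝ × ℝ => deriv φ z.1 • g z.2) (μ.prod μ) := by
      have hd' : Integrable (deriv φ) μ := (hd.integrable_of_hasCompactSupport h2.deriv).restrict
      exact hd'.smul_prod hg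
    have hS : MeasurableSet {z : ℝ × ℝ | 0 < z.2 ∧ z.2 ≤ z.1} :=
      (measurableSet_lt measurable_const measurable_snd).inter
        (measurableSet_le measurable_snd measurable_fst)
    refine (hA.indicator hS).congr (Eventually.of_forall fun z => ?_)
    simp only [Function.uncurry, hF, indicator, mem_ofPred_eq]
  have swap := integral_integral_swap hint
  have e1 : ∀ x ∈ Ioo 0 L, ∫ t, F x t ∂μ = deriv φ x • ∫ t in (0 : ℝ)..x, g t := by
    intro x hx
    rw [intervalIntegral.integral_of_le hx.1.le, ← integral_smul]
    simp only [F]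
    rw [integral_indicator measurableSet_Ioc, hμ, Measure.restrict_restrict measurableSet_Ioc,
      inter_eq_left.2 (show Ioc 0 x ⊆ Ioo 0 L from fun t ht => ⟨ht.1, ht.2.trans_lt hx.2⟩)]
  have e2 : ∀ t ∈ Ioo 0 L, ∫ x, F x t ∂μ = - (φ t • g t) := by
    intro t ht
    have : ∀ x, F x t = (Ici t).indicator (fun x => deriv φ x • g t) x := by
      intro x; simp [hF, indicator, ht.1]
    simp_rw [this]
    rw [integral_indicator measurableSet_Ici, hμ, Measure.restrict_restrict measurableSet_Ici,
      integral_smul_const]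
    have : Ici t ∩ Ioo 0 L = Ico t L := by
      ext x; simp only [mem_inter_iff, mem_Ici, mem_Ioo, mem_Ico]
      constructor
      · rintro ⟨a, b, c⟩; exact ⟨a, c⟩
      · rintro ⟨a, c⟩; exact ⟨a, ht.1.trans_le a, c⟩
    rw [this, integral_Ico_eq_integral_Ioo, ← integral_Ioc_eq_integral_Ioo,
      ← intervalIntegral.integral_of_le ht.2.le,
      intervalIntegral.integral_deriv_eq_sub
        (fun x _ => (h1.differentiable (by simp)).differentiableAt) (hd.intervalIntegrable _ _),
      image_eq_zero_of_notMem_tsupport (fun h => lt_irrefl _ (h3 h).2), zero_sub, neg_smul]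
  rw [setIntegral_congr_fun measurableSet_Ioo e1, setIntegral_congr_fun measurableSet_Ioo e2,
    integral_neg] at swap
  exact swap

/-- Du Bois-Reymond lemma: a function on an interval with vanishing weak derivative is constant. -/
lemma ae_const_of_test {L : ℝ} (hL : 0 < L) {h : ℝ → ℂ} (hh : IntegrableOn h (Ioo 0 L))
    (H : ∀ φ : ℝ → ℝ, ContDiff ℝ ∞ φ → HasCompactSupport φ → tsupport φ ⊆ Ioo 0 L →
      ∫ x in Ioo 0 L, deriv φ x • h x = 0) :
    ∃ c : ℂ, h =ᵐ[volume.restrict (Ioo 0 L)] fun _ => c := by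
  let B : ContDiffBump (L / 2) := ⟨L / 8, L / 4, by positivity, by linarith⟩
  let b : ℝ → ℝ := B.normed volume
  have b1 : ContDiff ℝ ∞ b := B.contDiff_normed
  have b2 : HasCompactSupport b := B.hasCompactSupport_normed
  have b3 : tsupport b ⊆ Ioo 0 L := by
    rw [B.tsupport_normed_eq, Real.closedBall_eq_Icc]
    intro x hx
    simp only [B, mem_Icc] at hx
    constructor <;> linarith [hx.1, hx.2]
  have b4 : ∫ x, b x = 1 := B.integral_normed
  refine ⟨∫ x in Ioo 0 L, b x • h x, ?_⟩
  set C := ∫ x in Ioo 0 L, b x • h x with hC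
  have hcst : IntegrableOn (fun _ : ℝ => C) (Ioo 0 L) := integrableOn_const (by simp)
  have := ae_zero_of_test (hh.sub hcst) ?_
  · filter_upwards [this] with x hx
    exact sub_eq_zero.1 hx
  intro ψ h1 h2 h3
  let c : ℝ := ∫ x, ψ x
  let χ : ℝ → ℝ := fun x => ψ x - c * b x
  have χ1 : ContDiff ℝ ∞ χ := h1.sub (contDiff_const.mul b1)
  have χint : ∫ x, χ x = 0 := by
    simp only [χ]
    rw [integral_sub (h1.continuous.integrable_of_hasCompactSupport h2)
      ((b1.continuous.integrable_of_hasCompactSupport b2).const_mul _), integral_const_mul, b4]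
    simp [c]
  let K := (tsupport ψ ∪ tsupport b) ∪ {L / 2}
  have hK : IsCompact K := (h2.isCompact.union b2.isCompact).union isCompact_singleton
  have hKs : K ⊆ Ioo 0 L := union_subset (union_subset h3 b3)
    (singleton_subset_iff.2 ⟨by positivity, by linarith⟩)
  have hKn : K.Nonempty := ⟨L / 2, Or.inr rfl⟩
  obtain ⟨p, hp, hp'⟩ := hK.exists_isLeast hKn
  obtain ⟨q, hq, hq'⟩ := hK.exists_isGreatest hKn
  have χout : ∀ x ∉ K, χ x = 0 := by
    intro x hx
    simp only [χ, image_eq_zero_of_notMem_tsupport (fun h => hx (Or.inl (Or.inl h))),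
      image_eq_zero_of_notMem_tsupport (f := b) (fun h => hx (Or.inl (Or.inr h)))]
    simp
  let φ : ℝ → ℝ := fun x => ∫ t in (0 : ℝ)..x, χ t
  have hφ' : ∀ x, HasDerivAt φ (χ x) x := fun x =>
    intervalIntegral.integral_hasDerivAt_right (χ1.continuous.intervalIntegrable _ _)
      (χ1.continuous.stronglyMeasurableAtFilter _ _) χ1.continuous.continuousAt
  have hφd : deriv φ = χ := funext fun x => (hφ' x).deriv
  have φ1 : ContDiff ℝ ∞ φ :=
    contDiff_infty_iff_deriv.2 ⟨fun x => (hφ' x).differentiableAt, hφd ▸ χ1⟩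
  have hsub : Function.support φ ⊆ Icc p q := by
    intro x hx
    by_contra hx'
    apply hx
    rw [mem_Icc, not_and_or, not_le, not_le] at hx'
    rcases hx' with hx' | hx'
    · refine intervalIntegral.integral_zero_ae (Eventually.of_forall fun t ht => χout t fun htK => ?_)
      rcases mem_uIoc.1 ht with ht | ht
      · linarith [hp' htK, ht.2]
      · linarith [(hKs htK).1, ht.2]
    · rw [← χint]
      simp only [φ]
      have h0 : (0 : ℝ) ≤ x := ((hKs hq).1.trans hx').le
      rw [intervalIntegral.integral_of_le h0]
      refine setIntegral_eq_integral_of_forall_compl_eq_zero fun t ht => χout t fun htK => ht ?_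
      exact ⟨(hKs htK).1, (hq' htK).trans hx'.le⟩
  have φ2 : HasCompactSupport φ := HasCompactSupport.of_support_subset_isCompact isCompact_Icc hsub
  have φ3 : tsupport φ ⊆ Ioo 0 L := (closure_minimal hsub isClosed_Icc).trans
    (fun x hx => ⟨(hKs hp).1.trans_le hx.1, hx.2.trans_lt (hKs hq).2⟩)
  have e := H φ φ1 φ2 φ3
  rw [hφd] at e
  have iψ := integrable_smul hh h1.continuous h2
  have ib := integrable_smul hh b1.continuous b2
  have e' : ∫ x in Ioo 0 L, χ x • h x
      = (∫ x in Ioo 0 L, ψ x • h x) - c • ∫ x in Ioo 0 L, b x • h x := by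
    have ib' : IntegrableOn (fun x => c • (b x • h x)) (Ioo 0 L) := ib.smul c
    rw [← integral_smul, ← integral_sub iψ ib']
    refine integral_congr_ae (Eventually.of_forall fun x => ?_)
    simp only [χ, sub_smul, mul_smul]
  simp only [Pi.sub_apply, smul_sub]
  rw [integral_sub iψ (integrable_smul hcst h1.continuous h2), integral_smul_const,
    setIntegral_eq_integral_of_forall_compl_eq_zero (f := ψ)
      (fun x hx => image_eq_zero_of_notMem_tsupport fun hx' => hx (h3 hx'))]
  rw [e'] at e
  exact e

/-- Every function with a weak derivative in `L²(0, L)` is a.e. equal to a primitive of it. -/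
lemma IsWeakDeriv.ae_eq_primitive {L : ℝ} (hL : 0 < L) {f g : L2 L} (h : IsWeakDeriv L f g) :
    ∃ c : ℂ, f =ᵐ[volume.restrict (Ioo 0 L)] fun x => c + ∫ t in (0 : ℝ)..x, g t := by
  have hg' : IntegrableOn g (uIcc 0 L) := by
    rw [uIcc_of_le hL.le, integrableOn_Icc_iff_integrableOn_Ioo]; exact integrableOn_L2 g
  have hG : IntegrableOn (fun x => ∫ t in (0 : ℝ)..x, g t) (Ioo 0 L) := by
    have := (intervalIntegral.continuousOn_primitive_interval (μ := volume) hg').integrableOn_compact (μ := volume)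
      isCompact_uIcc
    rw [uIcc_of_le hL.le] at this
    exact this.mono_set Ioo_subset_Icc_self
  obtain ⟨c, hc⟩ := ae_const_of_test hL ((integrableOn_L2 f).sub hG) (fun φ h1 h2 h3 => by
    have hd : Continuous (deriv φ) := h1.continuous_deriv (by simp)
    simp only [Pi.sub_apply, smul_sub]
    rw [integral_sub (integrable_smul (integrableOn_L2 f) hd h2.deriv)
      (integrable_smul hG hd h2.deriv), h φ h1 h2 h3,
      integral_deriv_smul_primitive (integrableOn_L2 g) h1 h2 h3, sub_self])
  refine ⟨c, ?_⟩
  filter_upwards [hc] with x hx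
  rw [← hx]; simp

lemma IsWeakDeriv.exists_continuousOn {L : ℝ} (hL : 0 < L) {f g : L2 L} (h : IsWeakDeriv L f g) :
    ∃ F : ℝ → ℂ, ContinuousOn F (Icc 0 L) ∧ f =ᵐ[volume.restrict (Ioo 0 L)] F := by
  obtain ⟨c, hc⟩ := h.ae_eq_primitive hL
  refine ⟨_, ?_, hc⟩
  have hg' : IntegrableOn g (uIcc 0 L) := by
    rw [uIcc_of_le hL.le, integrableOn_Icc_iff_integrableOn_Ioo]; exact integrableOn_L2 g
  have := intervalIntegral.continuousOn_primitive_interval (μ := volume) hg'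
  rw [uIcc_of_le hL.le] at this
  exact continuousOn_const.add this

/-- The Sobolev space `H¹(0, L)`. -/
def H1 (L : ℝ) : Submodule ℂ (L2 L) where
  carrier := {f | ∃ g : L2 L, IsWeakDeriv L f g}
  add_mem' := fun ⟨g, hg⟩ ⟨g', hg'⟩ => ⟨g + g', hg.add hg'⟩
  zero_mem' := ⟨0, IsWeakDeriv.zero⟩
  smul_mem' := fun c _ ⟨g, hg⟩ => ⟨c • g, hg.smul c⟩

open Classical in
/-- The weak derivative `f_x` of `f` (the junk value `0` if `f ∉ H¹(0, L)`). -/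
def weakDeriv (L : ℝ) (f : L2 L) : L2 L :=
  if h : ∃ g : L2 L, IsWeakDeriv L f g then h.choose else 0

lemma isWeakDeriv_weakDeriv {L : ℝ} {f : L2 L} (hf : f ∈ H1 L) :
    IsWeakDeriv L f (weakDeriv L f) := by
  have hf' : ∃ g : L2 L, IsWeakDeriv L f g := hf
  rw [weakDeriv, dif_pos hf']
  exact hf'.choose_spec

lemma IsWeakDeriv.weakDeriv_eq {L : ℝ} {f g : L2 L} (h : IsWeakDeriv L f g) :
    weakDeriv L f = g :=
  (isWeakDeriv_weakDeriv ⟨g, h⟩).unique h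

lemma weakDeriv_add {L : ℝ} {f g : L2 L} (hf : f ∈ H1 L) (hg : g ∈ H1 L) :
    weakDeriv L (f + g) = weakDeriv L f + weakDeriv L g :=
  ((isWeakDeriv_weakDeriv hf).add (isWeakDeriv_weakDeriv hg)).weakDeriv_eq

lemma weakDeriv_smul {L : ℝ} {f : L2 L} (c : ℂ) (hf : f ∈ H1 L) :
    weakDeriv L (c • f) = c • weakDeriv L f :=
  ((isWeakDeriv_weakDeriv hf).smul c).weakDeriv_eq

/-- The Sobolev space `H²(0, L)`. -/
def H2 (L : ℝ) : Submodule ℂ (L2 L) where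
  carrier := {f | f ∈ H1 L ∧ weakDeriv L f ∈ H1 L}
  add_mem' := by
    rintro f g ⟨hf, hf'⟩ ⟨hg, hg'⟩
    exact ⟨add_mem hf hg, by rw [weakDeriv_add hf hg]; exact add_mem hf' hg'⟩
  zero_mem' := ⟨zero_mem _, by rw [IsWeakDeriv.zero.weakDeriv_eq]; exact zero_mem _⟩
  smul_mem' := by
    rintro c f ⟨hf, hf'⟩
    exact ⟨Submodule.smul_mem _ c hf, by
      rw [weakDeriv_smul c hf]; exact Submodule.smul_mem _ c hf'⟩

open Classical in
/-- The value `f(x)`, `x ∈ [0, L]`, of the continuous representative of `f` on `[0, L]`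
(the junk value `0` if there is none; every `f ∈ H¹(0, L)` has exactly one). -/
def valueAt (L : ℝ) (f : L2 L) (x : ℝ) : ℂ :=
  if h : ∃ F : ℝ → ℂ, ContinuousOn F (Icc 0 L) ∧ f =ᵐ[volume.restrict (Ioo 0 L)] F
    then h.choose x else 0

lemma valueAt_eq {L : ℝ} (hL : 0 < L) {f : L2 L} {F : ℝ → ℂ} (hF : ContinuousOn F (Icc 0 L))
    (h : f =ᵐ[volume.restrict (Ioo 0 L)] F) {x : ℝ} (hx : x ∈ Icc 0 L) : valueAt L f x = F x := by
  have hex : ∃ F : ℝ → ℂ, ContinuousOn F (Icc 0 L) ∧ f =ᵐ[volume.restrict (Ioo 0 L)] F :=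
    ⟨F, hF, h⟩
  rw [valueAt, dif_pos hex]
  obtain ⟨h1, h2⟩ := hex.choose_spec
  have e : hex.choose =ᵐ[volume.restrict (Icc 0 L)] F := by
    rw [restrict_Ioo_eq_restrict_Icc.symm]
    exact h2.symm.trans h
  exact Measure.eqOn_Icc_of_ae_eq volume hL.ne e h1 hF hx

lemma valueAt_add {L : ℝ} (hL : 0 < L) {f g : L2 L} (hf : f ∈ H1 L) (hg : g ∈ H1 L) {x : ℝ}
    (hx : x ∈ Icc 0 L) : valueAt L (f + g) x = valueAt L f x + valueAt L g x := by
  obtain ⟨F, hF, hF'⟩ := (isWeakDeriv_weakDeriv hf).exists_continuousOn hL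
  obtain ⟨G, hG, hG'⟩ := (isWeakDeriv_weakDeriv hg).exists_continuousOn hL
  rw [valueAt_eq hL hF hF' hx, valueAt_eq hL hG hG' hx]
  exact valueAt_eq hL (hF.add hG) ((Lp.coeFn_add f g).trans (hF'.add hG')) hx

lemma valueAt_smul {L : ℝ} (hL : 0 < L) {f : L2 L} (c : ℂ) (hf : f ∈ H1 L) {x : ℝ}
    (hx : x ∈ Icc 0 L) : valueAt L (c • f) x = c * valueAt L f x := by
  obtain ⟨F, hF, hF'⟩ := (isWeakDeriv_weakDeriv hf).exists_continuousOn hL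
  rw [valueAt_eq hL hF hF' hx]
  exact valueAt_eq hL (hF.const_smul c) ((Lp.coeFn_smul c f).trans (hF'.const_smul c)) hx

lemma valueAt_zero {L : ℝ} (hL : 0 < L) {x : ℝ} (hx : x ∈ Icc 0 L) :
    valueAt L (0 : L2 L) x = 0 :=
  valueAt_eq hL (F := 0) continuousOn_const (Lp.coeFn_zero _ _ _) hx

/-! ### The beam, its energy space and its generator -/

/-- The parameters of the beam: its length `L`, the density `ρ`, the magnetic permeability `μ`, the
stiffness `α₁`, the impermeability `β`, the piezoelectric coefficient `γ`, the feedback gains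
`ξ₁, ξ₂` and the tip masses `m₁, m₂`. -/
structure Params where
  (L ρ μ α₁ β γ ξ₁ ξ₂ m₁ m₂ : ℝ)
  L_pos : 0 < L
  ρ_pos : 0 < ρ
  μ_pos : 0 < μ
  α₁_pos : 0 < α₁
  β_pos : 0 < β
  ξ₁_pos : 0 < ξ₁
  ξ₂_pos : 0 < ξ₂
  m₁_pos : 0 < m₁
  m₂_pos : 0 < m₂

/-- The elastic stiffness `α = α₁ + γ² β`. -/
def Params.α (p : Params) : ℝ := p.α₁ + p.γ ^ 2 * p.β

lemma Params.left_mem (p : Params) : (0 : ℝ) ∈ Icc 0 p.L := ⟨le_rfl, p.L_pos.le⟩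

lemma Params.right_mem (p : Params) : p.L ∈ Icc 0 p.L := ⟨p.L_pos.le, le_rfl⟩

/-- `H¹_*(0, L) = {f ∈ H¹(0, L) : f(0) = 0}`. -/
def H1star (p : Params) : Submodule ℂ (L2 p.L) where
  carrier := {f | f ∈ H1 p.L ∧ valueAt p.L f 0 = 0}
  add_mem' := by
    rintro f g ⟨hf, hf'⟩ ⟨hg, hg'⟩
    exact ⟨add_mem hf hg, by rw [valueAt_add p.L_pos hf hg p.left_mem, hf', hg', add_zero]⟩
  zero_mem' := ⟨zero_mem _, valueAt_zero p.L_pos p.left_mem⟩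
  smul_mem' := by
    rintro c f ⟨hf, hf'⟩
    exact ⟨Submodule.smul_mem _ c hf, by
      rw [valueAt_smul p.L_pos c hf p.left_mem, hf', mul_zero]⟩

lemma H1star.eq_zero {p : Params} {f : L2 p.L} (hf : f ∈ H1star p) (h0 : weakDeriv p.L f = 0) :
    f = 0 := by
  obtain ⟨c, hc⟩ := (isWeakDeriv_weakDeriv hf.1).ae_eq_primitive p.L_pos
  rw [h0] at hc
  have hz : ∀ x ∈ Ioo 0 p.L, ∫ t in (0 : ℝ)..x, (0 : L2 p.L) t = 0 := by
    intro x hx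
    rw [intervalIntegral.integral_of_le hx.1.le]
    refine integral_eq_zero_of_ae ?_
    exact ae_restrict_of_ae_restrict_of_subset
      (show Ioc 0 x ⊆ Ioo 0 p.L from fun t ht => ⟨ht.1, ht.2.trans_lt hx.2⟩)
      (Lp.coeFn_zero ℂ 2 (volume.restrict (Ioo (0 : ℝ) p.L)))
  have hc' : f =ᵐ[volume.restrict (Ioo 0 p.L)] fun _ => c := by
    filter_upwards [hc, ae_restrict_mem measurableSet_Ioo] with x hx hx'
    rw [hx, hz x hx', add_zero]
  have c0 : c = 0 := by
    rw [← hf.2, valueAt_eq p.L_pos continuousOn_const hc' p.left_mem]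
  refine Lp.ext ?_
  filter_upwards [hc', Lp.coeFn_zero ℂ 2 (volume.restrict (Ioo (0 : ℝ) p.L))] with x hx hx'
  rw [hx, hx', c0]; rfl

/-- The energy space `ℋ = H¹_* × L² × H¹_* × L² × ℂ × ℂ`, whose elements are written
`U = (V, Φ, P, Θ, u, η)`. -/
def EnergySpace (p : Params) : Type :=
  H1star p × L2 p.L × H1star p × L2 p.L × ℂ × ℂ

namespace EnergySpace

variable {p : Params}

instance : AddCommGroup (EnergySpace p) :=
  inferInstanceAs (AddCommGroup (H1star p × L2 p.L × H1star p × L2 p.L × ℂ × ℂ))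

instance : Module ℂ (EnergySpace p) :=
  inferInstanceAs (Module ℂ (H1star p × L2 p.L × H1star p × L2 p.L × ℂ × ℂ))

def V (U : EnergySpace p) : H1star p := U.1
def Φ (U : EnergySpace p) : L2 p.L := U.2.1
def P (U : EnergySpace p) : H1star p := U.2.2.1
def Θ (U : EnergySpace p) : L2 p.L := U.2.2.2.1
def u (U : EnergySpace p) : ℂ := U.2.2.2.2.1
def η (U : EnergySpace p) : ℂ := U.2.2.2.2.2

/-- `V_x` -/
def Vx (U : EnergySpace p) : L2 p.L := weakDeriv p.L U.V
/-- `P_x` -/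
def Px (U : EnergySpace p) : L2 p.L := weakDeriv p.L U.P
/-- `V_xx` (meaningful if `V ∈ H²(0, L)`) -/
def Vxx (U : EnergySpace p) : L2 p.L := weakDeriv p.L U.Vx
/-- `P_xx` (meaningful if `P ∈ H²(0, L)`) -/
def Pxx (U : EnergySpace p) : L2 p.L := weakDeriv p.L U.Px

@[simp] lemma V_add (U W : EnergySpace p) : (U + W).V = U.V + W.V := rfl
@[simp] lemma Φ_add (U W : EnergySpace p) : (U + W).Φ = U.Φ + W.Φ := rfl
@[simp] lemma P_add (U W : EnergySpace p) : (U + W).P = U.P + W.P := rfl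
@[simp] lemma Θ_add (U W : EnergySpace p) : (U + W).Θ = U.Θ + W.Θ := rfl
@[simp] lemma u_add (U W : EnergySpace p) : (U + W).u = U.u + W.u := rfl
@[simp] lemma η_add (U W : EnergySpace p) : (U + W).η = U.η + W.η := rfl
@[simp] lemma V_smul (c : ℂ) (U : EnergySpace p) : (c • U).V = c • U.V := rfl
@[simp] lemma Φ_smul (c : ℂ) (U : EnergySpace p) : (c • U).Φ = c • U.Φ := rfl
@[simp] lemma P_smul (c : ℂ) (U : EnergySpace p) : (c • U).P = c • U.P := rfl
@[simp] lemma Θ_smul (c : ℂ) (U : EnergySpace p) : (c • U).Θ = c • U.Θ := rfl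
@[simp] lemma u_smul (c : ℂ) (U : EnergySpace p) : (c • U).u = c • U.u := rfl
@[simp] lemma η_smul (c : ℂ) (U : EnergySpace p) : (c • U).η = c • U.η := rfl

@[simp] lemma Vx_add (U W : EnergySpace p) : (U + W).Vx = U.Vx + W.Vx :=
  weakDeriv_add U.V.2.1 W.V.2.1
@[simp] lemma Px_add (U W : EnergySpace p) : (U + W).Px = U.Px + W.Px :=
  weakDeriv_add U.P.2.1 W.P.2.1
@[simp] lemma Vx_smul (c : ℂ) (U : EnergySpace p) : (c • U).Vx = c • U.Vx :=
  weakDeriv_smul c U.V.2.1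
@[simp] lemma Px_smul (c : ℂ) (U : EnergySpace p) : (c • U).Px = c • U.Px :=
  weakDeriv_smul c U.P.2.1

/-- The energy inner product
`∫₀ᴸ [ρ Φ₁ Φ̄₂ + μ Θ₁ Θ̄₂ + α₁ V₁ₓ V̄₂ₓ + β (γ V₁ₓ - P₁ₓ) conj (γ V₂ₓ - P₂ₓ)] dx
  + m₁ u₁ ū₂ + m₂ η₁ η̄₂`, which is linear in `U₁`. -/
def energyInner (U₁ U₂ : EnergySpace p) : ℂ :=
  (∫ x in Ioo 0 p.L, ((p.ρ : ℂ) * (U₁.Φ x * conj (U₂.Φ x)) + (p.μ : ℂ) * (U₁.Θ x * conj (U₂.Θ x))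
      + (p.α₁ : ℂ) * (U₁.Vx x * conj (U₂.Vx x))
      + (p.β : ℂ) * (((p.γ : ℂ) * U₁.Vx x - U₁.Px x) * conj ((p.γ : ℂ) * U₂.Vx x - U₂.Px x))))
    + (p.m₁ : ℂ) * (U₁.u * conj U₂.u) + (p.m₂ : ℂ) * (U₁.η * conj U₂.η)

/-- The energy inner product in terms of the inner products of `L²(0, L)` and `ℂ` (which are
conjugate-linear in the first argument in Mathlib). -/
lemma energyInner_eq (U₁ U₂ : EnergySpace p) : energyInner U₁ U₂ =
    (p.ρ : ℂ) * inner ℂ U₂.Φ U₁.Φ + (p.μ : ℂ) * inner ℂ U₂.Θ U₁.Θ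
      + (p.α₁ : ℂ) * inner ℂ U₂.Vx U₁.Vx
      + (p.β : ℂ) * inner ℂ ((p.γ : ℂ) • U₂.Vx - U₂.Px) ((p.γ : ℂ) • U₁.Vx - U₁.Px)
      + (p.m₁ : ℂ) * inner ℂ U₂.u U₁.u + (p.m₂ : ℂ) * inner ℂ U₂.η U₁.η := by
  have key : ∫ x in Ioo 0 p.L, ((p.ρ : ℂ) * (U₁.Φ x * conj (U₂.Φ x))
      + (p.μ : ℂ) * (U₁.Θ x * conj (U₂.Θ x)) + (p.α₁ : ℂ) * (U₁.Vx x * conj (U₂.Vx x))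
      + (p.β : ℂ) * (((p.γ : ℂ) * U₁.Vx x - U₁.Px x) * conj ((p.γ : ℂ) * U₂.Vx x - U₂.Px x)))
      = ∫ x in Ioo 0 p.L, ((p.ρ : ℂ) * inner ℂ (U₂.Φ x) (U₁.Φ x)
        + (p.μ : ℂ) * inner ℂ (U₂.Θ x) (U₁.Θ x) + (p.α₁ : ℂ) * inner ℂ (U₂.Vx x) (U₁.Vx x)
        + (p.β : ℂ) * inner ℂ (((p.γ : ℂ) • U₂.Vx - U₂.Px : L2 p.L) x)
            (((p.γ : ℂ) • U₁.Vx - U₁.Px : L2 p.L) x)) := by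
    refine integral_congr_ae ?_
    filter_upwards [Lp.coeFn_sub ((p.γ : ℂ) • U₁.Vx) U₁.Px, Lp.coeFn_smul (p.γ : ℂ) U₁.Vx,
      Lp.coeFn_sub ((p.γ : ℂ) • U₂.Vx) U₂.Px, Lp.coeFn_smul (p.γ : ℂ) U₂.Vx] with x h1 h2 h3 h4
    rw [h1, h3, Pi.sub_apply, Pi.sub_apply, h2, h4]
    simp only [Pi.smul_apply, smul_eq_mul, RCLike.inner_apply]
  have i1 := (L2.integrable_inner (𝕜 := ℂ) U₂.Φ U₁.Φ).const_mul (p.ρ : ℂ)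
  have i2 := (L2.integrable_inner (𝕜 := ℂ) U₂.Θ U₁.Θ).const_mul (p.μ : ℂ)
  have i3 := (L2.integrable_inner (𝕜 := ℂ) U₂.Vx U₁.Vx).const_mul (p.α₁ : ℂ)
  have i4 := (L2.integrable_inner (𝕜 := ℂ) ((p.γ : ℂ) • U₂.Vx - U₂.Px)
    ((p.γ : ℂ) • U₁.Vx - U₁.Px)).const_mul (p.β : ℂ)
  have s3 := integral_add ((i1.add i2).add i3) i4
  have s2 := integral_add (i1.add i2) i3
  have s1 := integral_add i1 i2
  simp only [Pi.add_apply] at s1 s2 s3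
  rw [energyInner, key, s3, s2, s1]
  simp only [integral_const_mul, L2.inner_def, RCLike.inner_apply]

/-- The energy inner product as a (definite) inner product on `ℋ`; `inner ℂ U₁ U₂` is
`energyInner U₂ U₁`, since Mathlib's inner products are linear in the second argument. -/
@[reducible] def innerCore (p : Params) : InnerProductSpace.Core ℂ (EnergySpace p) where
  inner U₁ U₂ := energyInner U₂ U₁
  conj_inner_symm U₁ U₂ := by
    simp only [energyInner_eq, map_add, map_mul, inner_conj_symm, Complex.conj_ofReal]
  re_inner_nonneg U := by
    have hr : ∀ {E : Type} [NormedAddCommGroup E] [InnerProductSpace ℂ E] (r : ℝ) (x : E),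
        ((r : ℂ) * inner ℂ x x).re = r * ‖x‖ ^ 2 := by
      intro E _ _ r x
      rw [inner_self_eq_norm_sq_to_K, Complex.re_ofReal_mul]; norm_cast
    simp only [energyInner_eq, RCLike.re_to_complex, Complex.add_re, hr]
    have := p.ρ_pos; have := p.μ_pos; have := p.α₁_pos; have := p.β_pos
    have := p.m₁_pos; have := p.m₂_pos
    positivity
  add_left U₁ U₂ W := by
    simp only [energyInner_eq, Φ_add, Θ_add, Vx_add, Px_add, u_add, η_add, smul_add,
      add_sub_add_comm, inner_add_left]
    ring
  smul_left U W c := by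
    simp only [energyInner_eq, Φ_smul, Θ_smul, Vx_smul, Px_smul, u_smul, η_smul,
      smul_comm (p.γ : ℂ) c, ← smul_sub, inner_smul_left]
    ring
  definite U h := by
    have hr : ∀ {E : Type} [NormedAddCommGroup E] [InnerProductSpace ℂ E] (r : ℝ) (x : E),
        ((r : ℂ) * inner ℂ x x).re = r * ‖x‖ ^ 2 := by
      intro E _ _ r x
      rw [inner_self_eq_norm_sq_to_K, Complex.re_ofReal_mul]; norm_cast
    have h' := congrArg Complex.re h
    simp only [energyInner_eq, Complex.add_re, hr, Complex.zero_re] at h'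
    have z : ∀ {E : Type} [NormedAddCommGroup E] {r : ℝ} {x : E}, 0 < r → r * ‖x‖ ^ 2 ≤ 0 →
        x = 0 := by
      intro E _ r x h0 h1
      have : ‖x‖ ^ 2 ≤ 0 := by
        by_contra hc
        exact absurd h1 (not_le.2 (mul_pos h0 (not_le.1 hc)))
      exact norm_eq_zero.1 (pow_eq_zero_iff two_ne_zero |>.1 (le_antisymm this (sq_nonneg _)))
    have n1 := mul_nonneg p.ρ_pos.le (sq_nonneg ‖U.Φ‖)
    have n2 := mul_nonneg p.μ_pos.le (sq_nonneg ‖U.Θ‖)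
    have n3 := mul_nonneg p.α₁_pos.le (sq_nonneg ‖U.Vx‖)
    have n4 := mul_nonneg p.β_pos.le (sq_nonneg ‖(p.γ : ℂ) • U.Vx - U.Px‖)
    have n5 := mul_nonneg p.m₁_pos.le (sq_nonneg ‖U.u‖)
    have n6 := mul_nonneg p.m₂_pos.le (sq_nonneg ‖U.η‖)
    have hΦ := z p.ρ_pos (x := U.Φ) (by linarith)
    have hΘ := z p.μ_pos (x := U.Θ) (by linarith)
    have hVx := z p.α₁_pos (x := U.Vx) (by linarith)
    have hW := z p.β_pos (x := (p.γ : ℂ) • U.Vx - U.Px) (by linarith)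
    have hu := z p.m₁_pos (x := U.u) (by linarith)
    have hη := z p.m₂_pos (x := U.η) (by linarith)
    rw [hVx, smul_zero, zero_sub, neg_eq_zero] at hW
    have hV : U.V = 0 := Subtype.ext (H1star.eq_zero U.V.2 hVx)
    have hP : U.P = 0 := Subtype.ext (H1star.eq_zero U.P.2 hW)
    exact Prod.ext hV (Prod.ext hΦ (Prod.ext hP (Prod.ext hΘ (Prod.ext hu hη))))

instance : NormedAddCommGroup (EnergySpace p) :=
  @InnerProductSpace.Core.toNormedAddCommGroup ℂ (EnergySpace p) _ _ _ (innerCore p)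

instance : InnerProductSpace ℂ (EnergySpace p) :=
  InnerProductSpace.ofCore (innerCore p).toCore

end EnergySpace

open EnergySpace

/-- The operator `𝒜` on `ℋ` with domain
`{U ∈ ℋ : Φ, Θ ∈ H¹_*, V, P ∈ H², Φ(L) = u, Θ(L) = η}`. -/
def generator (p : Params) : EnergySpace p →ₗ.[ℂ] EnergySpace p where
  domain :=
    { carrier := {U | U.Φ ∈ H1star p ∧ U.Θ ∈ H1star p ∧
        (U.V : L2 p.L) ∈ H2 p.L ∧ (U.P : L2 p.L) ∈ H2 p.L ∧
        valueAt p.L U.Φ p.L = U.u ∧ valueAt p.L U.Θ p.L = U.η}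
      add_mem' := by
        rintro U W ⟨h1, h2, h3, h4, h5, h6⟩ ⟨k1, k2, k3, k4, k5, k6⟩
        refine ⟨add_mem h1 k1, add_mem h2 k2, add_mem h3 k3, add_mem h4 k4, ?_, ?_⟩
        · rw [Φ_add, valueAt_add p.L_pos h1.1 k1.1 p.right_mem, h5, k5, u_add]
        · rw [Θ_add, valueAt_add p.L_pos h2.1 k2.1 p.right_mem, h6, k6, η_add]
      zero_mem' := ⟨zero_mem _, zero_mem _, zero_mem _, zero_mem _,
        valueAt_zero p.L_pos p.right_mem, valueAt_zero p.L_pos p.right_mem⟩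
      smul_mem' := by
        rintro c U ⟨h1, h2, h3, h4, h5, h6⟩
        refine ⟨Submodule.smul_mem _ c h1, Submodule.smul_mem _ c h2, Submodule.smul_mem _ c h3,
          Submodule.smul_mem _ c h4, ?_, ?_⟩
        · rw [Φ_smul, valueAt_smul p.L_pos c h1.1 p.right_mem, h5, u_smul, smul_eq_mul]
        · rw [Θ_smul, valueAt_smul p.L_pos c h2.1 p.right_mem, h6, η_smul, smul_eq_mul] }
  toFun :=
    { toFun := fun U =>
        (⟨U.1.Φ, U.2.1⟩,
          ((p.α / p.ρ : ℝ) : ℂ) • U.1.Vxx - ((p.γ * p.β / p.ρ : ℝ) : ℂ) • U.1.Pxx,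
          ⟨U.1.Θ, U.2.2.1⟩,
          -((p.γ * p.β / p.μ : ℝ) : ℂ) • U.1.Vxx + ((p.β / p.μ : ℝ) : ℂ) • U.1.Pxx,
          -((p.α / p.m₁ : ℝ) : ℂ) * valueAt p.L U.1.Vx p.L
            + ((p.γ * p.β / p.m₁ : ℝ) : ℂ) * valueAt p.L U.1.Px p.L
            - ((p.ξ₁ / p.m₁ : ℝ) : ℂ) * U.1.u,
          ((p.γ * p.β / p.m₂ : ℝ) : ℂ) * valueAt p.L U.1.Vx p.L
            - ((p.β / p.m₂ : ℝ) : ℂ) * valueAt p.L U.1.Px p.L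
            - ((p.ξ₂ / p.m₂ : ℝ) : ℂ) * U.1.η)
      map_add' := by
        rintro ⟨U, h1, h2, h3, h4, -⟩ ⟨W, k1, k2, k3, k4, -⟩
        have a1 : (U + W).Vxx = U.Vxx + W.Vxx := by
          rw [Vxx, Vx_add]; exact weakDeriv_add h3.2 k3.2
        have a2 : (U + W).Pxx = U.Pxx + W.Pxx := by
          rw [Pxx, Px_add]; exact weakDeriv_add h4.2 k4.2
        have a3 : valueAt p.L (U + W).Vx p.L = valueAt p.L U.Vx p.L + valueAt p.L W.Vx p.L := by
          rw [Vx_add]; exact valueAt_add p.L_pos h3.2 k3.2 p.right_mem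
        have a4 : valueAt p.L (U + W).Px p.L = valueAt p.L U.Px p.L + valueAt p.L W.Px p.L := by
          rw [Px_add]; exact valueAt_add p.L_pos h4.2 k4.2 p.right_mem
        refine Prod.ext (Subtype.ext rfl) (Prod.ext ?_ (Prod.ext (Subtype.ext rfl)
          (Prod.ext ?_ (Prod.ext ?_ ?_))))
        · change _ • (U + W).Vxx - _ • (U + W).Pxx = (_ • U.Vxx - _ • U.Pxx) + (_ • W.Vxx - _ • W.Pxx)
          rw [a1, a2]; module
        · change _ • (U + W).Vxx + _ • (U + W).Pxx = (_ • U.Vxx + _ • U.Pxx) + (_ • W.Vxx + _ • W.Pxx)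
          rw [a1, a2]; module
        · change _ * valueAt p.L (U + W).Vx p.L + _ * valueAt p.L (U + W).Px p.L - _ * (U.u + W.u)
            = (_ * valueAt p.L U.Vx p.L + _ * valueAt p.L U.Px p.L - _ * U.u)
              + (_ * valueAt p.L W.Vx p.L + _ * valueAt p.L W.Px p.L - _ * W.u)
          rw [a3, a4]; ring
        · change _ * valueAt p.L (U + W).Vx p.L - _ * valueAt p.L (U + W).Px p.L - _ * (U.η + W.η)
            = (_ * valueAt p.L U.Vx p.L - _ * valueAt p.L U.Px p.L - _ * U.η)
              + (_ * valueAt p.L W.Vx p.L - _ * valueAt p.L W.Px p.L - _ * W.η)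
          rw [a3, a4]; ring
      map_smul' := by
        rintro c ⟨U, h1, h2, h3, h4, -⟩
        have a1 : (c • U).Vxx = c • U.Vxx := by
          rw [Vxx, Vx_smul]; exact weakDeriv_smul c h3.2
        have a2 : (c • U).Pxx = c • U.Pxx := by
          rw [Pxx, Px_smul]; exact weakDeriv_smul c h4.2
        have a3 : valueAt p.L (c • U).Vx p.L = c * valueAt p.L U.Vx p.L := by
          rw [Vx_smul]; exact valueAt_smul p.L_pos c h3.2 p.right_mem
        have a4 : valueAt p.L (c • U).Px p.L = c * valueAt p.L U.Px p.L := by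
          rw [Px_smul]; exact valueAt_smul p.L_pos c h4.2 p.right_mem
        refine Prod.ext (Subtype.ext rfl) (Prod.ext ?_ (Prod.ext (Subtype.ext rfl)
          (Prod.ext ?_ (Prod.ext ?_ ?_))))
        · change _ • (c • U).Vxx - _ • (c • U).Pxx = c • (_ • U.Vxx - _ • U.Pxx)
          rw [a1, a2]; module
        · change _ • (c • U).Vxx + _ • (c • U).Pxx = c • (_ • U.Vxx + _ • U.Pxx)
          rw [a1, a2]; module
        · change _ * valueAt p.L (c • U).Vx p.L + _ * valueAt p.L (c • U).Px p.L - _ * (c * U.u)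
            = c * (_ * valueAt p.L U.Vx p.L + _ * valueAt p.L U.Px p.L - _ * U.u)
          rw [a3, a4]; ring
        · change _ * valueAt p.L (c • U).Vx p.L - _ * valueAt p.L (c • U).Px p.L - _ * (c * U.η)
            = c * (_ * valueAt p.L U.Vx p.L - _ * valueAt p.L U.Px p.L - _ * U.η)
          rw [a3, a4]; ring }

/-! ### Contraction semigroups and solutions -/

section Semigroup

variable {X : Type*} [NormedAddCommGroup X] [NormedSpace ℂ X]

/-- `(S(t))_{t ≥ 0}` is a `C₀`-semigroup of contractions on `X`. -/
structure IsContractionSemigroup (S : ℝ≥0 → X →L[ℂ] X) : Prop where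
  map_zero : S 0 = ContinuousLinearMap.id ℂ X
  map_add : ∀ s t, S (s + t) = (S s).comp (S t)
  tendsto_zero : ∀ x, Tendsto (fun t => S t x) (𝓝[>] 0) (𝓝 x)
  norm_le_one : ∀ t, ‖S t‖ ≤ 1

/-- `A` is the infinitesimal generator of the semigroup `S`: one has `x ∈ D(A)` and `A x = y`
exactly if `(S(h) x - x) / h → y` as `h ↓ 0`. -/
def IsGeneratorOf (A : X →ₗ.[ℂ] X) (S : ℝ≥0 → X →L[ℂ] X) : Prop :=
  ∀ x y : X, (x, y) ∈ A.graph ↔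
    Tendsto (fun h : ℝ≥0 => ((h : ℝ) : ℂ)⁻¹ • (S h x - x)) (𝓝[>] 0) (𝓝 y)

/-- `U ∈ C([0,∞); D(A)) ∩ C¹([0,∞); X)` solves `U_t = A U`, `U(0) = U₀`, where `D(A)` carries
the graph norm. Only the values `U(t)` with `t ≥ 0` matter. -/
structure IsCauchySolution (A : X →ₗ.[ℂ] X) (U₀ : X) (U : ℝ → X) : Prop where
  mem_domain : ∀ t : ℝ≥0, U t ∈ A.domain
  continuous_graph : Continuous fun t : ℝ≥0 => ((U t, A ⟨U t, mem_domain t⟩) : X × X)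
  contDiffOn : ContDiffOn ℝ 1 U (Ici 0)
  hasDeriv : ∀ t : ℝ≥0, HasDerivWithinAt U (A ⟨U t, mem_domain t⟩) (Ici 0) t
  init : U 0 = U₀

end Semigroup

/-- The curve `U(t) = (V, Φ, P, Θ, u, η)(t)` in `C¹([0,∞); ℋ)`, with `V(t), P(t) ∈ H²(0, L)`,
solves the beam system with tip bodies: `Φ = V_t`, `Θ = P_t`, `u = V_t(L)`, `η = P_t(L)`,
the two wave equations hold in `L²(0, L)` for all `t ≥ 0`, and so do the boundary and initial
conditions. -/
structure IsBeamSolution (p : Params) (U₀ : EnergySpace p) (U : ℝ → EnergySpace p) : Prop where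
  contDiffOn : ContDiffOn ℝ 1 U (Ici 0)
  V_mem : ∀ t : ℝ≥0, ((U t).V : L2 p.L) ∈ H2 p.L
  P_mem : ∀ t : ℝ≥0, ((U t).P : L2 p.L) ∈ H2 p.L
  V_t : ∀ t : ℝ≥0, HasDerivWithinAt (fun s => ((U s).V : L2 p.L)) (U t).Φ (Ici 0) t
  P_t : ∀ t : ℝ≥0, HasDerivWithinAt (fun s => ((U s).P : L2 p.L)) (U t).Θ (Ici 0) t
  wave_V : ∀ t : ℝ≥0, ∃ Vtt : L2 p.L, HasDerivWithinAt (fun s => (U s).Φ) Vtt (Ici 0) t ∧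
    (p.ρ : ℂ) • Vtt - (p.α : ℂ) • (U t).Vxx + ((p.γ * p.β : ℝ) : ℂ) • (U t).Pxx = 0
  wave_P : ∀ t : ℝ≥0, ∃ Ptt : L2 p.L, HasDerivWithinAt (fun s => (U s).Θ) Ptt (Ici 0) t ∧
    (p.μ : ℂ) • Ptt - (p.β : ℂ) • (U t).Pxx + ((p.γ * p.β : ℝ) : ℂ) • (U t).Vxx = 0
  left_V : ∀ t : ℝ≥0, valueAt p.L (U t).V 0 = 0
  left_P : ∀ t : ℝ≥0, valueAt p.L (U t).P 0 = 0
  u_eq : ∀ t : ℝ≥0, valueAt p.L (U t).Φ p.L = (U t).u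
  η_eq : ∀ t : ℝ≥0, valueAt p.L (U t).Θ p.L = (U t).η
  tip_V : ∀ t : ℝ≥0, ∃ ut : ℂ, HasDerivWithinAt (fun s => (U s).u) ut (Ici 0) t ∧
    (p.α : ℂ) * valueAt p.L (U t).Vx p.L - ((p.γ * p.β : ℝ) : ℂ) * valueAt p.L (U t).Px p.L
      + (p.ξ₁ : ℂ) * (U t).u + (p.m₁ : ℂ) * ut = 0
  tip_P : ∀ t : ℝ≥0, ∃ ηt : ℂ, HasDerivWithinAt (fun s => (U s).η) ηt (Ici 0) t ∧
    (p.β : ℂ) * valueAt p.L (U t).Px p.L - ((p.γ * p.β : ℝ) : ℂ) * valueAt p.L (U t).Vx p.L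
      + (p.ξ₂ : ℂ) * (U t).η + (p.m₂ : ℂ) * ηt = 0
  init : U 0 = U₀

end PiezoBeam

end

/-!
The equivalence of the beam system with `U_t = 𝒜 U` holds since `V, P ∈ L²(0, L)`, `Φ`, `Θ`, `u`
and `η` depend continuously on the state in the energy norm (for `V` and `P` this is the Poincaré
inequality): the derivative of a curve in `ℋ` can be taken component by component, and `𝒜 U = W`
spells out the equations of the system (`generator_eq_iff`, `isBeamSolution_iff`).

Generation is the Lumer–Phillips theorem on a Hilbert space, in a form with resolvent point `0`:
a dissipative operator `A` that maps its domain *onto* the space generates a contraction semigroup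
(`exists_semigroup_of_dissipative_surjective`). Such an `A` is injective, and its inverse `R` is an
everywhere defined dissipative operator, hence bounded by the closed graph theorem, with dense
range. The operators `-(ε - R)⁻¹` are bounded, dissipative, commute, and converge to `A` on the
domain as `ε ↓ 0`; their exponentials are contractions that converge to the semigroup `S`. From
`S(t) R = R S(t)` and `S(t) R z - R z = ∫₀ᵗ S(s) z ds` one reads off both the generator and the
solution of the Cauchy problem, which is unique by the energy estimate for dissipative operators.

For the beam, integration by parts gives `Re ⟨𝒜 U, U⟩ = -ξ₁ |u|² - ξ₂ |η|²`
(`re_inner_generator`), and `𝒜 U = F` is solved by integrating twice, since the matrix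
`(α, -γβ; -γβ, β)` has determinant `α₁ β ≠ 0` (`generator_surjective`). The energy space is
complete because its coordinates `(V_x, Φ, P_x, Θ, u, η)` identify it with a product of complete
spaces.
-/

noncomputable section

namespace PiezoBeam

/-! ### Energy estimates and exponentials of bounded dissipative operators -/

section Generation

variable {X : Type*} [NormedAddCommGroup X] [InnerProductSpace ℂ X]

/-- Along a curve with `Re ⟨w', w⟩ ≤ 0` the norm does not grow. -/
lemma norm_le_of_re_inner_deriv_nonpos {w w' : ℝ → X}
    (hw : ∀ t : ℝ, 0 ≤ t → HasDerivWithinAt w (w' t) (Ici 0) t)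
    (h : ∀ t : ℝ, 0 ≤ t → (inner ℂ (w' t) (w t)).re ≤ 0) {t : ℝ} (ht : 0 ≤ t) :
    ‖w t‖ ≤ ‖w 0‖ := by
  let : InnerProductSpace ℝ X := InnerProductSpace.rclikeToReal ℂ X
  have hd : ∀ s : ℝ, 0 ≤ s →
      HasDerivWithinAt (fun s => ‖w s‖ ^ 2) (2 * inner ℝ (w s) (w' s)) (Ici 0) s :=
    fun s hs => (hw s hs).norm_sq
  have hanti : AntitoneOn (fun s => ‖w s‖ ^ 2) (Ici 0) := by
    refine antitoneOn_of_hasDerivWithinAt_nonpos (f' := fun s => 2 * inner ℝ (w s) (w' s))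
      (convex_Ici 0) (fun s hs => (hd s hs).continuousWithinAt) (fun s hs => ?_) (fun s hs => ?_)
    · exact (hd s (interior_subset hs)).mono interior_subset
    · have := h s (interior_subset hs)
      have e : inner ℝ (w s) (w' s) = (inner ℂ (w' s) (w s)).re := by
        rw [real_inner_comm]; rfl
      rw [e]; linarith
  have := hanti (mem_Ici.2 le_rfl) (mem_Ici.2 ht) ht
  exact (sq_le_sq₀ (norm_nonneg _) (norm_nonneg _)).1 this

/-- Contractions that converge on a dense range form, at each point, a Cauchy sequence. -/
lemma cauchySeq_of_denseRange {Y : Type*} {T : ℕ → X →L[ℂ] X} (hT : ∀ n x, ‖T n x‖ ≤ ‖x‖)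
    {r : Y → X} (hr : DenseRange r) (h : ∀ z, CauchySeq fun n => T n (r z)) (x : X) :
    CauchySeq fun n => T n x := by
  refine Metric.cauchySeq_iff'.2 fun ε hε => ?_
  obtain ⟨z, hz⟩ := hr.exists_dist_lt x (show 0 < ε / 3 by positivity)
  obtain ⟨N, hN⟩ := Metric.cauchySeq_iff'.1 (h z) (ε / 3) (by positivity)
  refine ⟨N, fun n hn => ?_⟩
  have h1 : ∀ k, dist (T k x) (T k (r z)) < ε / 3 := fun k => by
    rw [dist_eq_norm, ← map_sub]
    exact (hT k _).trans_lt (by rwa [← dist_eq_norm])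
  have h2 := dist_triangle4 (T n x) (T n (r z)) (T N (r z)) (T N x)
  have h3 := h1 N
  rw [dist_comm] at h3
  linarith [h1 n, hN n hn]

/-- Contractions that converge to a contraction on a dense range converge everywhere. -/
lemma tendsto_of_denseRange {Y ι : Type*} {l : Filter ι} {T : ι → X →L[ℂ] X} {T₀ : X →L[ℂ] X}
    (hT : ∀ n x, ‖T n x‖ ≤ ‖x‖) (hT₀ : ∀ x, ‖T₀ x‖ ≤ ‖x‖) {r : Y → X} (hr : DenseRange r)
    (h : ∀ z, Tendsto (fun n => T n (r z)) l (𝓝 (T₀ (r z)))) (x : X) :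
    Tendsto (fun n => T n x) l (𝓝 (T₀ x)) := by
  refine Metric.tendsto_nhds.2 fun ε hε => ?_
  obtain ⟨z, hz⟩ := hr.exists_dist_lt x (show 0 < ε / 3 by positivity)
  filter_upwards [Metric.tendsto_nhds.1 (h z) (ε / 3) (by positivity)] with n hn
  have h1 : ∀ A : X →L[ℂ] X, (∀ x, ‖A x‖ ≤ ‖x‖) → dist (A x) (A (r z)) < ε / 3 := fun A hA => by
    rw [dist_eq_norm, ← map_sub]
    exact (hA _).trans_lt (by rwa [← dist_eq_norm])
  have h2 := dist_triangle4 (T n x) (T n (r z)) (T₀ (r z)) (T₀ x)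
  have h3 := h1 T₀ hT₀
  rw [dist_comm] at h3
  linarith [h1 _ (hT n), hn]

variable [CompleteSpace X]

/-- The uniformly continuous group `e^{tB}` of a bounded operator `B`. -/
def expGroup (B : X →L[ℂ] X) (t : ℝ) : X →L[ℂ] X := NormedSpace.exp (t • B)

lemma expGroup_add (B : X →L[ℂ] X) (s t : ℝ) :
    expGroup B (s + t) = expGroup B s * expGroup B t := by
  let +nondep : NormedAlgebra ℚ (X →L[ℂ] X) := .restrictScalars ℚ ℂ _
  rw [expGroup, add_smul]
  exact NormedSpace.exp_add_of_commute (((Commute.refl B).smul_left s).smul_right t)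

lemma expGroup_zero (B : X →L[ℂ] X) : expGroup B 0 = 1 := by
  rw [expGroup, zero_smul, NormedSpace.exp_zero]

lemma expGroup_zero_left (t : ℝ) : expGroup (0 : X →L[ℂ] X) t = 1 := by
  rw [expGroup, smul_zero, NormedSpace.exp_zero]

lemma commute_expGroup {B C : X →L[ℂ] X} (h : Commute B C) (t : ℝ) :
    Commute (expGroup B t) C := by
  let +nondep : NormedAlgebra ℚ (X →L[ℂ] X) := .restrictScalars ℚ ℂ _
  exact (h.smul_left t).exp_left

lemma hasDerivAt_expGroup (B : X →L[ℂ] X) (x : X) (t : ℝ) :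
    HasDerivAt (fun t => expGroup B t x) (expGroup B t (B x)) t :=
  ((ContinuousLinearMap.apply ℂ X x).restrictScalars ℝ).hasFDerivAt.comp_hasDerivAt t
    (hasDerivAt_exp_smul_const (𝕂 := ℝ) B t)

/-- A bounded dissipative operator generates contractions. -/
lemma norm_expGroup_le {B : X →L[ℂ] X} (hB : ∀ x, (inner ℂ (B x) x).re ≤ 0) {t : ℝ} (ht : 0 ≤ t)
    (x : X) : ‖expGroup B t x‖ ≤ ‖x‖ := by
  have := norm_le_of_re_inner_deriv_nonpos (w := fun t => expGroup B t x)
    (fun s _ => (hasDerivAt_expGroup B x s).hasDerivWithinAt) (fun s _ => ?_) ht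
  · simpa [expGroup_zero] using this
  · have e := DFunLike.congr_fun (commute_expGroup (Commute.refl B) s).eq x
    change expGroup B s (B x) = B (expGroup B s x) at e
    rw [e]; exact hB _

/-- Exponentials of commuting dissipative operators differ at most as much as the operators do. -/
lemma norm_expGroup_sub_le {B C : X →L[ℂ] X} (hB : ∀ x, (inner ℂ (B x) x).re ≤ 0)
    (hC : ∀ x, (inner ℂ (C x) x).re ≤ 0) (hBC : Commute B C) {t : ℝ} (ht : 0 ≤ t) (x : X) :
    ‖expGroup C t x - expGroup B t x‖ ≤ t * ‖C x - B x‖ := by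
  let +nondep : NormedAlgebra ℚ (X →L[ℂ] X) := .restrictScalars ℚ ℂ _
  -- `s ↦ e^{(t - s)B} e^{sC} x = e^{tB} e^{s(C - B)} x` interpolates between the two terms
  have key : ∀ s : ℝ, expGroup B t * expGroup (C - B) s = expGroup B (t - s) * expGroup C s := by
    intro s
    have h1 : Commute (t • B) (s • (C - B)) :=
      ((hBC.sub_right (Commute.refl B)).smul_left t).smul_right s
    have h2 : Commute ((t - s) • B) (s • C) := (hBC.smul_left _).smul_right s
    simp only [expGroup]
    rw [← NormedSpace.exp_add_of_commute h1, ← NormedSpace.exp_add_of_commute h2]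
    congr 1
    module
  have hd : ∀ s : ℝ, HasDerivAt (fun s => expGroup B t (expGroup (C - B) s x))
      (expGroup B t (expGroup (C - B) s ((C - B) x))) s := fun s =>
    ((expGroup B t).restrictScalars ℝ).hasFDerivAt.comp_hasDerivAt s
      (hasDerivAt_expGroup (C - B) x s)
  have := norm_image_sub_le_of_norm_deriv_le_segment' (a := 0) (b := t) (C := ‖C x - B x‖)
    (fun s _ => (hd s).hasDerivWithinAt) (fun s hs => ?_) t (right_mem_Icc.2 ht)
  · rw [← mul_apply_eq_comp, ← mul_apply_eq_comp, key, key, sub_self,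
      expGroup_zero, sub_zero, expGroup_zero, mul_comm] at this
    simpa using this
  · rw [← mul_apply_eq_comp, key]
    exact (norm_expGroup_le hB (by linarith [hs.2]) _).trans (norm_expGroup_le hC hs.1 _)

end Generation

/-! ### Dissipative operators and their Yosida approximations -/

section Generation

variable {X : Type*} [NormedAddCommGroup X] [InnerProductSpace ℂ X]

lemma IsContractionSemigroup.norm_apply_le {S : ℝ≥0 → X →L[ℂ] X} (hS : IsContractionSemigroup S)
    (t : ℝ≥0) (x : X) : ‖S t x‖ ≤ ‖x‖ :=
  ((S t).le_of_opNorm_le (hS.norm_le_one t) x).trans_eq (one_mul _)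

/-- Strong right continuity at `0` gives strong continuity on `[0, ∞)`. -/
lemma IsContractionSemigroup.continuous {S : ℝ≥0 → X →L[ℂ] X} (hS : IsContractionSemigroup S)
    (x : X) : Continuous fun t : ℝ≥0 => S t x := by
  have hle : ∀ s t : ℝ≥0, s ≤ t → dist (S t x) (S s x) ≤ dist (S (t - s) x) x := by
    intro s t hst
    have : S t x = S s (S (t - s) x) := by
      rw [← ContinuousLinearMap.comp_apply, ← hS.map_add, add_tsub_cancel_of_le hst]
    rw [this, dist_eq_norm, ← map_sub, dist_eq_norm]
    exact hS.norm_apply_le _ _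
  have hle' : ∀ s t : ℝ≥0, dist (S t x) (S s x) ≤ dist (S (nndist t s) x) x := by
    intro s t
    rcases le_total s t with h | h
    · have : nndist t s = t - s := by
        rw [NNReal.nndist_eq, tsub_eq_zero_of_le h]; simp
      rw [this]; exact hle s t h
    · have : nndist t s = s - t := by
        rw [NNReal.nndist_eq, tsub_eq_zero_of_le h]; simp
      rw [this, dist_comm]; exact hle t s h
  have h0 : Tendsto (fun t => S t x) (𝓝 0) (𝓝 x) := by
    have h : ContinuousWithinAt (fun t => S t x) (Ioi 0) 0 := by
      have := hS.tendsto_zero x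
      rw [ContinuousWithinAt, hS.map_zero]
      exact this
    rw [continuousWithinAt_Ioi_iff_Ici, show Ici (0 : ℝ≥0) = univ from Ici_bot,
      continuousWithinAt_univ, ContinuousAt, hS.map_zero] at h
    exact h
  rw [continuous_iff_continuousAt]
  intro s
  refine tendsto_iff_dist_tendsto_zero.2 ?_
  refine squeeze_zero (fun _ => dist_nonneg) (fun t => hle' s t) ?_
  have h1 : Tendsto (fun t => nndist t s) (𝓝 s) (𝓝 0) := by
    have : Continuous fun t => nndist t s := by fun_prop
    simpa using this.tendsto s
  exact tendsto_iff_dist_tendsto_zero.1 (h0.comp h1)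

variable [CompleteSpace X]

/-- If `R` is dissipative and injective, `y ⟂ range R` forces `R y = 0`: expand
`Re ⟨R (y + t z), y + t z⟩ ≤ 0` to first order in `t`. -/
lemma denseRange_of_dissipative {R : X →L[ℂ] X} (hR : ∀ x, (inner ℂ (R x) x).re ≤ 0)
    (hinj : Function.Injective R) : DenseRange R := by
  have h : (R : X →ₗ[ℂ] X).range.topologicalClosure = ⊤ := by
    rw [Submodule.topologicalClosure_eq_top_iff, Submodule.eq_bot_iff]
    intro y hy
    have hy' : ∀ x, inner ℂ (R x) y = 0 := fun x => hy (R x) ⟨x, rfl⟩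
    refine hinj ?_
    rw [map_zero, ← norm_eq_zero]
    by_contra hne
    have hpos : 0 < ‖R y‖ ^ 2 := by positivity
    -- take `z = R y` and a small positive `t`
    have hq : ∀ t : ℝ, t * ‖R y‖ ^ 2 + t ^ 2 * (inner ℂ (R (R y)) (R y)).re ≤ 0 := by
      intro t
      have e : inner ℂ (R (y + (t : ℂ) • R y)) (y + (t : ℂ) • R y)
          = ((t * ‖R y‖ ^ 2 : ℝ) : ℂ) + ((t ^ 2 : ℝ) : ℂ) * inner ℂ (R (R y)) (R y) := by
        simp only [map_add, map_smul, inner_add_left, inner_add_right, inner_smul_left,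
          inner_smul_right, hy', inner_self_eq_norm_sq_to_K, Complex.conj_ofReal]
        push_cast
        simp only [Complex.coe_algebraMap]
        ring
      have := hR (y + (t : ℂ) • R y)
      rwa [e, Complex.add_re, Complex.ofReal_re, Complex.re_ofReal_mul] at this
    obtain ⟨c, hc⟩ : ∃ c, c = (inner ℂ (R (R y)) (R y)).re := ⟨_, rfl⟩
    simp only [← hc] at hq
    have h2 := hq (‖R y‖ ^ 2 / (2 * (|c| + 1)))
    have hc1 : 0 < |c| + 1 := by positivity
    set d := ‖R y‖ ^ 2
    have h3 : d / (2 * (|c| + 1)) * d + (d / (2 * (|c| + 1))) ^ 2 * c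
        = d ^ 2 * (2 * (|c| + 1) + c) / (2 * (|c| + 1)) ^ 2 := by
      field_simp
    rw [h3] at h2
    have h4 : 0 < 2 * (|c| + 1) + c := by linarith [neg_abs_le c]
    exact absurd h2 (not_le.2 (by positivity))
  intro x
  have hx : x ∈ (R : X →ₗ[ℂ] X).range.topologicalClosure := h ▸ Submodule.mem_top
  exact hx

/-- For dissipative `R` and `ε > 0` the operator `ε - R` has a bounded inverse. -/
lemma isUnit_smul_one_sub {R : X →L[ℂ] X} (hR : ∀ x, (inner ℂ (R x) x).re ≤ 0) {ε : ℝ}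
    (hε : 0 < ε) : IsUnit ((ε : ℂ) • (1 : X →L[ℂ] X) - R) := by
  refine ContinuousLinearMap.isUnit_of_forall_le_norm_inner_map _ (c := ⟨ε, hε.le⟩) hε fun x => ?_
  refine le_trans ?_ (Complex.re_le_norm _)
  change ‖x‖ ^ 2 * ε ≤ (inner ℂ ((ε : ℂ) • x - R x) x).re
  rw [inner_sub_left, inner_smul_left, inner_self_eq_norm_sq_to_K, Complex.sub_re,
    Complex.conj_ofReal, Complex.re_ofReal_mul]
  have : ((‖x‖ : ℂ) ^ 2).re = ‖x‖ ^ 2 := by norm_cast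
  change ‖x‖ ^ 2 * ε ≤ ε * ((‖x‖ : ℂ) ^ 2).re - _
  rw [this]
  linarith [hR x]

/-- The Yosida approximations `-(ε - R)⁻¹`, `ε = 1 / (n + 1)`, of the inverse of a dissipative
injective operator `R`: bounded dissipative operators, commuting with each other and with `R`,
that converge to `R⁻¹` on the range of `R`. -/
lemma exists_yosida_approximation {R : X →L[ℂ] X} (hR : ∀ x, (inner ℂ (R x) x).re ≤ 0)
    (hinj : Function.Injective R) :
    ∃ B : ℕ → X →L[ℂ] X, (∀ n x, (inner ℂ (B n x) x).re ≤ 0) ∧ (∀ n m, Commute (B n) (B m)) ∧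
      (∀ n, Commute (B n) R) ∧ ∀ z, Tendsto (fun n => B n (R z)) atTop (𝓝 z) := by
  have he : ∀ n : ℕ, 0 < 1 / ((n : ℝ) + 1) := fun n => Nat.one_div_pos_of_nat
  choose K hK using fun n => isUnit_smul_one_sub hR (he n)
  set e : ℕ → ℝ := fun n => 1 / ((n : ℝ) + 1) with hedef
  have hl : ∀ n x, (e n : ℂ) • (↑(K n)⁻¹ : X →L[ℂ] X) x - R ((↑(K n)⁻¹ : X →L[ℂ] X) x) = x := by
    intro n x
    have := DFunLike.congr_fun (K n).mul_inv x
    rw [hK] at this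
    exact this
  have hr : ∀ n x, (↑(K n)⁻¹ : X →L[ℂ] X) ((e n : ℂ) • x - R x) = x := by
    intro n x
    have := DFunLike.congr_fun (K n).inv_mul x
    rw [hK] at this
    exact this
  have hre : ∀ n x, (inner ℂ ((e n : ℂ) • x - R x) x).re = e n * ‖x‖ ^ 2 - (inner ℂ (R x) x).re := by
    intro n x
    rw [inner_sub_left, inner_smul_left, inner_self_eq_norm_sq_to_K, Complex.sub_re,
      Complex.conj_ofReal, Complex.re_ofReal_mul]
    norm_cast
  have hbd : ∀ n x, ‖((e n : ℂ) • (↑(K n)⁻¹ : X →L[ℂ] X)) x‖ ≤ ‖x‖ := by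
    intro n x
    set y := (↑(K n)⁻¹ : X →L[ℂ] X) x with hy
    have h1 := hre n y
    rw [hl] at h1
    have h2 : (inner ℂ x y).re ≤ ‖x‖ * ‖y‖ := (Complex.re_le_norm _).trans (norm_inner_le_norm _ _)
    have h3 : e n * ‖y‖ ^ 2 ≤ ‖x‖ * ‖y‖ := by linarith [hR y]
    change ‖(e n : ℂ) • y‖ ≤ ‖x‖
    rw [norm_smul, Complex.norm_of_nonneg (he n).le]
    rcases (norm_nonneg y).eq_or_lt with h0 | h0
    · rw [← h0, mul_zero]; exact norm_nonneg _
    · exact le_of_mul_le_mul_right (by linarith [h3, sq (‖y‖), mul_assoc (e n) ‖y‖ ‖y‖]) h0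
  have hKR : ∀ n, Commute (↑(K n)⁻¹ : X →L[ℂ] X) R := by
    intro n
    refine Commute.units_inv_left ?_
    rw [hK]
    exact ((Commute.one_left R).smul_left _).sub_left (Commute.refl R)
  have hden := denseRange_of_dissipative hR hinj
  refine ⟨fun n => -(↑(K n)⁻¹ : X →L[ℂ] X), fun n x => ?_, fun n m => ?_, fun n => ?_, fun z => ?_⟩
  · have h1 := hre n ((↑(K n)⁻¹ : X →L[ℂ] X) x)
    rw [hl] at h1
    change (inner ℂ (-((↑(K n)⁻¹ : X →L[ℂ] X) x)) x).re ≤ 0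
    rw [inner_neg_left, Complex.neg_re, ← inner_conj_symm, Complex.conj_re, h1]
    have := hR ((↑(K n)⁻¹ : X →L[ℂ] X) x)
    have := mul_nonneg (he n).le (sq_nonneg ‖(↑(K n)⁻¹ : X →L[ℂ] X) x‖)
    linarith
  · refine (Commute.neg_left ?_).neg_right
    refine Commute.units_inv_right ?_
    rw [hK]
    exact ((Commute.one_right _).smul_right _).sub_right (hKR n)
  · exact (hKR n).neg_left
  · -- `-(ε - R)⁻¹ R z = z - ε (ε - R)⁻¹ z`, and `ε (ε - R)⁻¹ → 0` strongly
    have h0 : Tendsto (fun n => ((e n : ℂ) • (↑(K n)⁻¹ : X →L[ℂ] X)) z) atTop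
        (𝓝 ((0 : X →L[ℂ] X) z)) := by
      refine tendsto_of_denseRange hbd (fun x => by simp) hden (fun w => ?_) z
      rw [zero_apply]
      refine squeeze_zero_norm (a := fun n => e n * (2 * ‖w‖)) (fun n => ?_) ?_
      · have h1 : ((e n : ℂ) • (↑(K n)⁻¹ : X →L[ℂ] X)) (R w)
            = (e n : ℂ) • (((e n : ℂ) • (↑(K n)⁻¹ : X →L[ℂ] X)) w - w) := by
          have := DFunLike.congr_fun (hKR n).eq w
          change (↑(K n)⁻¹ : X →L[ℂ] X) (R w) = R ((↑(K n)⁻¹ : X →L[ℂ] X) w) at this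
          change (e n : ℂ) • (↑(K n)⁻¹ : X →L[ℂ] X) (R w)
            = (e n : ℂ) • ((e n : ℂ) • (↑(K n)⁻¹ : X →L[ℂ] X) w - w)
          rw [this]
          congr 1
          rw [eq_sub_iff_add_eq, ← eq_sub_iff_add_eq']
          exact (hl n w).symm
        rw [h1, norm_smul, Complex.norm_of_nonneg (he n).le]
        refine mul_le_mul_of_nonneg_left ?_ (he n).le
        have := norm_sub_le (((e n : ℂ) • (↑(K n)⁻¹ : X →L[ℂ] X)) w) w
        linarith [hbd n w]
      · have := (tendsto_one_div_add_atTop_nhds_zero_nat (𝕜 := ℝ)).mul_const (2 * ‖w‖)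
        rwa [zero_mul] at this
    have h1 : ∀ n, (-(↑(K n)⁻¹ : X →L[ℂ] X)) (R z)
        = z - ((e n : ℂ) • (↑(K n)⁻¹ : X →L[ℂ] X)) z := by
      intro n
      have := hr n z
      rw [map_sub, map_smul] at this
      change -((↑(K n)⁻¹ : X →L[ℂ] X) (R z)) = z - (e n : ℂ) • (↑(K n)⁻¹ : X →L[ℂ] X) z
      rw [eq_sub_iff_add_eq, neg_add_eq_sub]
      exact this
    simp only [h1]
    have := h0.const_sub z
    rwa [zero_apply, sub_zero] at this

end Generation

/-! ### The generation theorem -/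

section Generation

variable {X : Type*} [NormedAddCommGroup X] [InnerProductSpace ℂ X]

/-- A dissipative surjective operator is injective: its kernel is orthogonal to its range. -/
lemma injective_of_dissipative_surjective {A : X →ₗ.[ℂ] X}
    (hA : ∀ x : A.domain, (inner ℂ (A x) (x : X)).re ≤ 0) (hsurj : Function.Surjective A) :
    Function.Injective A := by
  refine (injective_iff_map_eq_zero A.toFun).2 fun x hx => ?_
  obtain ⟨z, hz⟩ := hsurj (x : X)
  have h1 : ∀ t : ℝ, t * ‖(x : X)‖ ^ 2 + t ^ 2 * (inner ℂ (x : X) (z : X)).re ≤ 0 := by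
    intro t
    have := hA (x + (t : ℂ) • z)
    have e : inner ℂ (A (x + (t : ℂ) • z)) ((x + (t : ℂ) • z : A.domain) : X)
        = ((t * ‖(x : X)‖ ^ 2 : ℝ) : ℂ) + ((t ^ 2 : ℝ) : ℂ) * inner ℂ (x : X) (z : X) := by
      have hx' : A x = 0 := hx
      rw [A.map_add, A.map_smul, hz, hx', zero_add]
      simp only [Submodule.coe_add, Submodule.coe_smul, inner_add_right, inner_smul_left,
        inner_smul_right, inner_self_eq_norm_sq_to_K, Complex.conj_ofReal]
      push_cast
      simp only [Complex.coe_algebraMap]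
      ring
    rwa [e, Complex.add_re, Complex.ofReal_re, Complex.re_ofReal_mul] at this
  have h2 : ∀ t : ℝ, 0 < t → ‖(x : X)‖ ^ 2 + t * (inner ℂ (x : X) (z : X)).re ≤ 0 := by
    intro t ht
    have := h1 t
    by_contra hc
    have := mul_pos ht (not_le.1 hc)
    nlinarith
  have h3 : Tendsto (fun t : ℝ => ‖(x : X)‖ ^ 2 + t * (inner ℂ (x : X) (z : X)).re)
      (𝓝[>] 0) (𝓝 (‖(x : X)‖ ^ 2 + 0 * (inner ℂ (x : X) (z : X)).re)) :=
    (Continuous.tendsto (by fun_prop) 0).mono_left nhdsWithin_le_nhds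
  have h4 := le_of_tendsto h3 (eventually_mem_nhdsWithin.mono h2)
  rw [zero_mul, add_zero] at h4
  exact Subtype.ext (norm_eq_zero.1 ((pow_eq_zero_iff two_ne_zero).1
    (le_antisymm h4 (sq_nonneg _))))

/-- Uniqueness for the Cauchy problem of a dissipative operator, by the energy estimate. -/
lemma IsCauchySolution.unique {A : X →ₗ.[ℂ] X}
    (hA : ∀ x : A.domain, (inner ℂ (A x) (x : X)).re ≤ 0) {U₀ : X} {U W : ℝ → X}
    (hU : IsCauchySolution A U₀ U) (hW : IsCauchySolution A U₀ W) (t : ℝ≥0) : U t = W t := by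
  have hd : ∀ s : ℝ, 0 ≤ s → ∃ d, HasDerivWithinAt (fun s => U s - W s) d (Ici 0) s ∧
      (inner ℂ d (U s - W s)).re ≤ 0 := by
    intro s hs
    lift s to ℝ≥0 using hs
    refine ⟨_, (hU.hasDeriv s).sub (hW.hasDeriv s), ?_⟩
    rw [← A.map_sub]
    exact hA (⟨U s, hU.mem_domain s⟩ - ⟨W s, hW.mem_domain s⟩)
  choose! d hd1 hd2 using hd
  have := norm_le_of_re_inner_deriv_nonpos hd1 hd2 t.2
  rw [hU.init, hW.init, sub_self, norm_zero] at this
  exact sub_eq_zero.1 (norm_le_zero_iff.1 this)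

variable [CompleteSpace X]

/-- The contraction semigroup generated by the inverse of a bounded, dissipative, injective
operator `R`: the limit of the exponentials of the Yosida approximations. -/
theorem exists_contractionSemigroup {R : X →L[ℂ] X} (hR : ∀ x, (inner ℂ (R x) x).re ≤ 0)
    (hinj : Function.Injective R) :
    ∃ S : ℝ≥0 → X →L[ℂ] X, IsContractionSemigroup S ∧ (∀ t x, S t (R x) = R (S t x)) ∧
      ∀ (t : ℝ≥0) (z : X), S t (R z) - R z = ∫ s in (0 : ℝ)..t, S s.toNNReal z := by
  have hden := denseRange_of_dissipative hR hinj
  obtain ⟨B, hB, hBB, hBR, hlim⟩ := exists_yosida_approximation hR hinj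
  have hcontr : ∀ (t : ℝ≥0) n x, ‖expGroup (B n) t x‖ ≤ ‖x‖ :=
    fun t n x => norm_expGroup_le (hB n) t.2 x
  have hcau : ∀ (t : ℝ≥0) x, CauchySeq fun n => expGroup (B n) t x := by
    intro t
    refine cauchySeq_of_denseRange (hcontr t) hden fun z => ?_
    refine Metric.cauchySeq_iff'.2 fun ε hε => ?_
    have ht : 0 < (t : ℝ) + 1 := by positivity
    obtain ⟨N, hN⟩ := Metric.cauchySeq_iff'.1 (hlim z).cauchySeq (ε / (t + 1)) (by positivity)
    refine ⟨N, fun n hn => ?_⟩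
    rw [dist_eq_norm]
    refine (norm_expGroup_sub_le (hB N) (hB n) (hBB N n) t.2 (R z)).trans_lt ?_
    have h1 := hN n hn
    rw [dist_eq_norm, lt_div_iff₀ ht] at h1
    have h2 := norm_nonneg (B n (R z) - B N (R z))
    have h3 : (t : ℝ) * ‖B n (R z) - B N (R z)‖ ≤ ‖B n (R z) - B N (R z)‖ * (t + 1) := by
      nlinarith
    exact h3.trans_lt h1
  choose f hf using fun t x => cauchySeq_tendsto_of_complete (hcau t x)
  let S : ℝ≥0 → X →L[ℂ] X := fun t =>
    continuousLinearMapOfTendsto (fun n => expGroup (B n) t) (tendsto_pi_nhds.2 (hf t))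
  have hS : ∀ (t : ℝ≥0) x, Tendsto (fun n => expGroup (B n) t x) atTop (𝓝 (S t x)) := hf
  have hle : ∀ t x, ‖S t x‖ ≤ ‖x‖ := fun t x =>
    le_of_tendsto (hS t x).norm (Eventually.of_forall fun n => hcontr t n x)
  have hsemi : IsContractionSemigroup S := by
    refine ⟨?_, fun s t => ?_, fun x => ?_, fun t => ?_⟩
    · ext x
      refine tendsto_nhds_unique (hS 0 x) ?_
      simp [expGroup_zero]
    · ext x
      refine tendsto_nhds_unique (hS (s + t) x) ?_
      have h1 : ∀ n, expGroup (B n) ((s + t : ℝ≥0) : ℝ) x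
          = expGroup (B n) s (S t x) + expGroup (B n) s (expGroup (B n) t x - S t x) := by
        intro n
        rw [NNReal.coe_add, expGroup_add, mul_apply_eq_comp, ← map_add, add_sub_cancel]
      simp only [h1]
      have h2 : Tendsto (fun n => expGroup (B n) s (expGroup (B n) t x - S t x)) atTop (𝓝 0) := by
        refine squeeze_zero_norm (fun n => hcontr s n _) ?_
        exact tendsto_iff_norm_sub_tendsto_zero.1 (hS t x)
      have := (hS s (S t x)).add h2
      rwa [add_zero] at this
    · refine tendsto_of_denseRange (T₀ := ContinuousLinearMap.id ℂ X) hle (fun x => le_rfl) hden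
        (fun z => ?_) x
      have h1 : ∀ t : ℝ≥0, ‖S t (R z) - R z‖ ≤ t * ‖z‖ := by
        intro t
        refine le_of_tendsto_of_tendsto ((hS t (R z)).sub_const (R z)).norm
          ((hlim z).norm.const_mul (t : ℝ)) (Eventually.of_forall fun n => ?_)
        have := norm_expGroup_sub_le (B := 0) (by simp) (hB n) (Commute.zero_left _) t.2 (R z)
        simpa [expGroup_zero_left] using this
      refine tendsto_iff_norm_sub_tendsto_zero.2 (squeeze_zero (fun _ => norm_nonneg _) h1 ?_)
      have : Tendsto (fun t : ℝ≥0 => (t : ℝ) * ‖z‖) (𝓝 0) (𝓝 (((0 : ℝ≥0) : ℝ) * ‖z‖)) :=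
        Continuous.tendsto (by fun_prop) 0
      rw [NNReal.coe_zero, zero_mul] at this
      exact this.mono_left nhdsWithin_le_nhds
    · exact ContinuousLinearMap.opNorm_le_bound _ zero_le_one fun x => by
        rw [one_mul]; exact hle t x
  refine ⟨S, hsemi, fun t x => ?_, fun t z => ?_⟩
  · refine tendsto_nhds_unique (hS t (R x)) ?_
    have h1 : ∀ n, expGroup (B n) t (R x) = R (expGroup (B n) t x) := fun n =>
      DFunLike.congr_fun (commute_expGroup (hBR n) t).eq x
    simp only [h1]
    exact (R.continuous.tendsto _).comp (hS t x)
  · have hcont : ∀ n, Continuous fun s => expGroup (B n) s (B n (R z)) := fun n =>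
      continuous_iff_continuousAt.2 fun s => (hasDerivAt_expGroup (B n) _ s).continuousAt
    have h1 : ∀ n, expGroup (B n) t (R z) - R z
        = ∫ s in (0 : ℝ)..t, expGroup (B n) s (B n (R z)) := by
      intro n
      rw [intervalIntegral.integral_eq_sub_of_hasDerivAt
        (fun s _ => hasDerivAt_expGroup (B n) (R z) s) ((hcont n).intervalIntegrable _ _),
        expGroup_zero]
      rfl
    refine tendsto_nhds_unique ((hS t (R z)).sub_const (R z)) ?_
    simp only [h1]
    obtain ⟨C, hC⟩ := (hlim z).norm.bddAbove_range
    refine intervalIntegral.tendsto_integral_filter_of_dominated_convergence (fun _ => C)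
      (Eventually.of_forall fun n => (hcont n).aestronglyMeasurable)
      (Eventually.of_forall fun n => Eventually.of_forall fun s hs => ?_)
      intervalIntegrable_const (Eventually.of_forall fun s hs => ?_)
    · rw [uIoc_of_le t.coe_nonneg] at hs
      exact (norm_expGroup_le (hB n) hs.1.le _).trans (hC ⟨n, rfl⟩)
    · rw [uIoc_of_le t.coe_nonneg] at hs
      have h2 : ∀ n, expGroup (B n) s (B n (R z))
          = expGroup (B n) s z + expGroup (B n) s (B n (R z) - z) := by
        intro n; rw [← map_add, add_sub_cancel]
      simp only [h2]
      have h3 : Tendsto (fun n => expGroup (B n) s (B n (R z) - z)) atTop (𝓝 0) := by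
        refine squeeze_zero_norm (fun n => norm_expGroup_le (hB n) hs.1.le _) ?_
        exact tendsto_iff_norm_sub_tendsto_zero.1 (hlim z)
      have h4 := hS s.toNNReal z
      rw [Real.coe_toNNReal s hs.1.le] at h4
      have := h4.add h3
      rwa [add_zero] at this

/-- An everywhere defined dissipative operator is bounded, by the closed graph theorem. -/
lemma continuous_of_dissipative {R : X →ₗ[ℂ] X} (hR : ∀ x, (inner ℂ (R x) x).re ≤ 0) :
    Continuous R := by
  refine R.continuous_of_seq_closed_graph fun v x y hv hRv => ?_
  -- `Re ⟨R (v n - x + z), v n - x + z⟩ ≤ 0` tends to `Re ⟨y - R x + R z, z⟩ ≤ 0`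
  have h1 : ∀ z, (inner ℂ (y - R x + R z) z).re ≤ 0 := by
    intro z
    have hl : Tendsto (fun n => (inner ℂ (R (v n) - R x + R z) (v n - x + z)).re) atTop
        (𝓝 (inner ℂ (y - R x + R z) (x - x + z)).re) :=
      (Complex.continuous_re.tendsto _).comp
        (((hRv.sub_const _).add_const _).inner ((hv.sub_const _).add_const _))
    rw [sub_self, zero_add] at hl
    refine le_of_tendsto hl (Eventually.of_forall fun n => ?_)
    rw [← map_sub, ← map_add]
    exact hR _
  -- replace `z` by `t (y - R x)` with small `t > 0`
  have h2 : ∀ t : ℝ, 0 < t →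
      ‖y - R x‖ ^ 2 + t * (inner ℂ (R (y - R x)) (y - R x)).re ≤ 0 := by
    intro t ht
    have := h1 ((t : ℂ) • (y - R x))
    have e : inner ℂ (y - R x + R ((t : ℂ) • (y - R x))) ((t : ℂ) • (y - R x))
        = (t : ℂ) * (((‖y - R x‖ ^ 2 : ℝ) : ℂ) + (t : ℂ) * inner ℂ (R (y - R x)) (y - R x)) := by
      simp only [map_smul, inner_add_left, inner_smul_left, inner_smul_right,
        inner_self_eq_norm_sq_to_K, Complex.conj_ofReal]
      push_cast
      simp only [Complex.coe_algebraMap]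
    rw [e, Complex.re_ofReal_mul, Complex.add_re, Complex.ofReal_re, Complex.re_ofReal_mul] at this
    by_contra hc
    exact absurd this (not_le.2 (mul_pos ht (not_le.1 hc)))
  have h3 : Tendsto (fun t : ℝ => ‖y - R x‖ ^ 2 + t * (inner ℂ (R (y - R x)) (y - R x)).re)
      (𝓝[>] 0) (𝓝 (‖y - R x‖ ^ 2 + 0 * (inner ℂ (R (y - R x)) (y - R x)).re)) :=
    (Continuous.tendsto (by fun_prop) 0).mono_left nhdsWithin_le_nhds
  have h4 := le_of_tendsto h3 (eventually_mem_nhdsWithin.mono h2)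
  rw [zero_mul, add_zero] at h4
  rw [← sub_eq_zero, ← norm_eq_zero]
  exact (pow_eq_zero_iff two_ne_zero).1 (le_antisymm h4 (sq_nonneg _))

/-- A dissipative operator of a Hilbert space that maps its domain onto the space generates a
contraction semigroup, which solves its Cauchy problem. -/
theorem exists_semigroup_of_dissipative_surjective {A : X →ₗ.[ℂ] X}
    (hA : ∀ x : A.domain, (inner ℂ (A x) (x : X)).re ≤ 0) (hsurj : Function.Surjective A) :
    ∃ S : ℝ≥0 → X →L[ℂ] X, IsContractionSemigroup S ∧ IsGeneratorOf A S ∧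
      ∀ U₀ ∈ A.domain, IsCauchySolution A U₀ (fun t => S t.toNNReal U₀) := by
  let e : A.domain ≃ₗ[ℂ] X :=
    LinearEquiv.ofBijective A.toFun ⟨injective_of_dissipative_surjective hA hsurj, hsurj⟩
  have he : ∀ x, A (e.symm x) = x := fun x => e.apply_symm_apply x
  have hdis : ∀ x, (inner ℂ ((A.domain.subtype ∘ₗ e.symm.toLinearMap) x) x).re ≤ 0 := by
    intro x
    have := hA (e.symm x)
    rw [he, ← inner_conj_symm, Complex.conj_re] at this
    exact this
  obtain ⟨R, hRe⟩ : ∃ R : X →L[ℂ] X, ∀ x, R x = e.symm x :=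
    ⟨⟨A.domain.subtype ∘ₗ e.symm.toLinearMap, continuous_of_dissipative hdis⟩, fun x => rfl⟩
  have hR : ∀ x, (inner ℂ (R x) x).re ≤ 0 := fun x => by rw [hRe]; exact hdis x
  have hinj : Function.Injective R := fun x y h => by
    rw [hRe, hRe] at h
    exact e.symm.injective (Subtype.ext h)
  have hmem : ∀ y, R y ∈ A.domain := fun y => by rw [hRe]; exact (e.symm y).2
  have hAR : ∀ y, A ⟨R y, hmem y⟩ = y := fun y => by
    rw [show (⟨R y, hmem y⟩ : A.domain) = e.symm y from Subtype.ext (hRe y), he]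
  have hRA : ∀ x : A.domain, R (A x) = x := fun x => by
    rw [hRe]; exact congrArg Subtype.val (e.symm_apply_apply x)
  obtain ⟨S, hS, hSR, hint⟩ := exists_contractionSemigroup hR hinj
  have hc : ∀ z, Continuous fun s : ℝ => S s.toNNReal z := fun z =>
    (hS.continuous z).comp continuous_real_toNNReal
  have hder : ∀ (t : ℝ≥0) z, HasDerivWithinAt (fun s : ℝ => S s.toNNReal (R z)) (S t z) (Ici 0) t := by
    intro t z
    have h1 : HasDerivAt (fun s : ℝ => R z + ∫ r in (0 : ℝ)..s, S r.toNNReal z)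
        (S (t : ℝ).toNNReal z) t :=
      (intervalIntegral.integral_hasDerivAt_right ((hc z).intervalIntegrable _ _)
        ((hc z).stronglyMeasurableAtFilter _ _) (hc z).continuousAt).const_add _
    rw [Real.toNNReal_coe] at h1
    have h2 : ∀ s ∈ Ici (0 : ℝ), S s.toNNReal (R z) = R z + ∫ r in (0 : ℝ)..s, S r.toNNReal z := by
      intro s hs
      have := hint s.toNNReal z
      rw [Real.coe_toNNReal s hs] at this
      rw [← this, add_sub_cancel]
    exact h1.hasDerivWithinAt.congr h2 (h2 _ t.2)
  have hright : ∀ z, Tendsto (fun h : ℝ≥0 => ((h : ℝ) : ℂ)⁻¹ • (S h (R z) - R z)) (𝓝[>] 0)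
      (𝓝 z) := by
    intro z
    have h1 := (hder 0 z).mono Ioi_subset_Ici_self
    rw [hasDerivWithinAt_iff_tendsto_slope' (by simp)] at h1
    have h2 : Tendsto (fun h : ℝ≥0 => (h : ℝ)) (𝓝[>] 0) (𝓝[Ioi 0] ((0 : ℝ≥0) : ℝ)) := by
      refine tendsto_nhdsWithin_iff.2 ⟨?_, ?_⟩
      · exact (NNReal.continuous_coe.tendsto 0).mono_left nhdsWithin_le_nhds
      · filter_upwards [self_mem_nhdsWithin] with h hh
        exact NNReal.coe_pos.2 hh
    have h3 := h1.comp h2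
    rw [hS.map_zero] at h3
    refine h3.congr fun h => ?_
    simp only [Function.comp, slope, vsub_eq_sub, NNReal.coe_zero, sub_zero, Real.toNNReal_coe,
      Real.toNNReal_zero, hS.map_zero]
    rw [← Complex.ofReal_inv, Complex.coe_smul]
    rfl
  refine ⟨S, hS, fun x y => ?_, fun U₀ hU₀ => ?_⟩
  · constructor
    · intro h
      obtain ⟨x', hx1, hx2⟩ := (LinearPMap.mem_graph_iff A).1 h
      simp only at hx1 hx2
      rw [← hx1, ← hx2, ← hRA x']
      have e : A ⟨R (A x'), hmem _⟩ = A x' := hAR _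
      exact hright _
    · intro h
      -- apply `R` to the difference quotient, whose limit is then known
      have h1 := (R.continuous.tendsto y).comp h
      have h2 : R y = x := by
        refine tendsto_nhds_unique h1 ((hright x).congr fun r => ?_)
        simp only [Function.comp, map_smul, map_sub, hSR]
      rw [LinearPMap.mem_graph_iff]
      exact ⟨⟨R y, hmem y⟩, h2, hAR y⟩
  · obtain ⟨z, rfl⟩ : ∃ z, R z = U₀ := ⟨A ⟨U₀, hU₀⟩, hRA ⟨U₀, hU₀⟩⟩
    have hA' : ∀ t (h : S t (R z) ∈ A.domain), A ⟨S t (R z), h⟩ = S t z := by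
      intro t h
      rw [← hAR (S t z)]
      congr 1
      exact Subtype.ext (hSR t z)
    have hm : ∀ t : ℝ≥0, S (t : ℝ).toNNReal (R z) ∈ A.domain := fun t => by
      rw [hSR]; exact hmem _
    have hder' : ∀ t : ℝ, 0 ≤ t →
        HasDerivWithinAt (fun s : ℝ => S s.toNNReal (R z)) (S t.toNNReal z) (Ici 0) t := by
      intro t ht
      have := hder t.toNNReal z
      rwa [Real.coe_toNNReal t ht] at this
    refine ⟨hm, ?_, ?_, fun t => ?_, ?_⟩
    · simp only [hA', Real.toNNReal_coe]
      exact (hS.continuous _).prodMk (hS.continuous _)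
    · refine (contDiffOn_one_iff_derivWithin (uniqueDiffOn_Ici 0)).2
        ⟨fun t ht => (hder' t ht).differentiableWithinAt, ?_⟩
      refine (hc z).continuousOn.congr fun t ht => ?_
      exact (hder' t ht).derivWithin (uniqueDiffOn_Ici 0 t ht)
    · rw [hA']; exact hder' t t.2
    · simp [hS.map_zero]

end Generation

/-! ### Primitives and integration by parts in `H¹(0, L)` -/

section Sobolev

variable {L : ℝ}

lemma continuousOn_primitive (hL : 0 < L) {g : ℝ → ℂ} (hg : IntegrableOn g (Ioo 0 L)) (c : ℂ) :
    ContinuousOn (fun x => c + ∫ t in (0 : ℝ)..x, g t) (Icc 0 L) := by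
  have hg' : IntegrableOn g (uIcc 0 L) := by
    rwa [uIcc_of_le hL.le, integrableOn_Icc_iff_integrableOn_Ioo]
  have := intervalIntegral.continuousOn_primitive_interval (μ := volume) hg'
  rw [uIcc_of_le hL.le] at this
  exact continuousOn_const.add this

/-- Every `f ∈ H¹(0, L)` is the primitive of its weak derivative with initial value `f(0)`. -/
lemma ae_eq_primitive_weakDeriv (hL : 0 < L) {f : L2 L} (hf : f ∈ H1 L) :
    f =ᵐ[volume.restrict (Ioo 0 L)]
      fun x => valueAt L f 0 + ∫ t in (0 : ℝ)..x, weakDeriv L f t := by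
  obtain ⟨c, hc⟩ := (isWeakDeriv_weakDeriv hf).ae_eq_primitive hL
  have : valueAt L f 0 = c := by
    rw [valueAt_eq hL (continuousOn_primitive hL (integrableOn_L2 _) c) hc ⟨le_rfl, hL.le⟩,
      intervalIntegral.integral_same, add_zero]
  rw [this]; exact hc

lemma valueAt_eq_primitive (hL : 0 < L) {f : L2 L} (hf : f ∈ H1 L) {x : ℝ} (hx : x ∈ Icc 0 L) :
    valueAt L f x = valueAt L f 0 + ∫ t in (0 : ℝ)..x, weakDeriv L f t :=
  valueAt_eq hL (continuousOn_primitive hL (integrableOn_L2 _) _) (ae_eq_primitive_weakDeriv hL hf)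
    hx

/-- Every `g ∈ L²(0, L)` has a primitive in `H¹(0, L)` with a prescribed initial value. -/
lemma exists_primitive (hL : 0 < L) (g : L2 L) (c : ℂ) :
    ∃ f ∈ H1 L, weakDeriv L f = g ∧ valueAt L f 0 = c := by
  have hcont := continuousOn_primitive hL (integrableOn_L2 g) c
  have hmeas : AEStronglyMeasurable (fun x => c + ∫ t in (0 : ℝ)..x, g t)
      (volume.restrict (Ioo 0 L)) :=
    (hcont.mono Ioo_subset_Icc_self).aestronglyMeasurable measurableSet_Ioo
  obtain ⟨C, hC⟩ := isCompact_Icc.exists_bound_of_continuousOn hcont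
  have hmem : MemLp (fun x => c + ∫ t in (0 : ℝ)..x, g t) 2 (volume.restrict (Ioo 0 L)) :=
    MemLp.of_bound hmeas C ((ae_restrict_iff' measurableSet_Ioo).2
      (Eventually.of_forall fun x hx => hC x (Ioo_subset_Icc_self hx)))
  have hae := hmem.coeFn_toLp
  have hG : IntegrableOn (fun x => ∫ t in (0 : ℝ)..x, g t) (Ioo 0 L) := by
    have := (continuousOn_primitive hL (integrableOn_L2 g) 0).integrableOn_compact (μ := volume)
      isCompact_Icc
    simp only [zero_add] at this
    exact this.mono_set Ioo_subset_Icc_self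
  have hw : IsWeakDeriv L (hmem.toLp _) g := by
    intro φ h1 h2 h3
    have hd : Continuous (deriv φ) := h1.continuous_deriv (by simp)
    have hdc : IntegrableOn (fun _ : ℝ => c) (Ioo 0 L) := integrableOn_const (by simp)
    have e : ∫ x in Ioo 0 L, deriv φ x • (hmem.toLp _ : L2 L) x
        = ∫ x in Ioo 0 L, (deriv φ x • c + deriv φ x • ∫ t in (0 : ℝ)..x, g t) := by
      refine integral_congr_ae ?_
      filter_upwards [hae] with x hx
      rw [hx, smul_add]
    have e0 : ∫ x in Ioo 0 L, deriv φ x • c = 0 := by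
      rw [integral_smul_const, ← integral_Ioc_eq_integral_Ioo,
        ← intervalIntegral.integral_of_le hL.le, intervalIntegral.integral_deriv_eq_sub
          (fun x _ => (h1.differentiable (by simp)).differentiableAt) (hd.intervalIntegrable _ _),
        image_eq_zero_of_notMem_tsupport (fun h => lt_irrefl _ (h3 h).2),
        image_eq_zero_of_notMem_tsupport (fun h => lt_irrefl _ (h3 h).1), sub_zero, zero_smul]
    rw [e, integral_add (integrable_smul hdc hd h2.deriv) (integrable_smul hG hd h2.deriv), e0,
      zero_add, integral_deriv_smul_primitive (integrableOn_L2 g) h1 h2 h3]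
  refine ⟨hmem.toLp _, ⟨g, hw⟩, hw.weakDeriv_eq, ?_⟩
  rw [valueAt_eq hL hcont hae ⟨le_rfl, hL.le⟩, intervalIntegral.integral_same, add_zero]

/-- The primitive may also be normalized at the right end point. -/
lemma exists_primitive_right (hL : 0 < L) (g : L2 L) (c : ℂ) :
    ∃ f ∈ H1 L, weakDeriv L f = g ∧ valueAt L f L = c := by
  obtain ⟨f, hf, hg, h0⟩ := exists_primitive hL g (c - ∫ t in (0 : ℝ)..L, g t)
  exact ⟨f, hf, hg, by rw [valueAt_eq_primitive hL hf ⟨hL.le, le_rfl⟩, hg, h0, sub_add_cancel]⟩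

/-- Fubini's theorem on the two triangles of the square `(0, L)²`. -/
lemma integral_mul_primitive_add (hL : 0 < L) {g h : ℝ → ℂ} (hg : IntegrableOn g (Ioo 0 L))
    (hh : IntegrableOn h (Ioo 0 L)) :
    (∫ x in Ioo 0 L, g x * ∫ t in (0 : ℝ)..x, h t) + ∫ x in Ioo 0 L, (∫ t in (0 : ℝ)..x, g t) * h x
      = (∫ t in (0 : ℝ)..L, g t) * ∫ t in (0 : ℝ)..L, h t := by
  set μ := volume.restrict (Ioo (0 : ℝ) L) with hμ
  let T : Set (ℝ × ℝ) := {z | z.2 ≤ z.1}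
  have hT : MeasurableSet T := measurableSet_le measurable_snd measurable_fst
  have hint : Integrable (fun z : ℝ × ℝ => g z.1 * h z.2) (μ.prod μ) := hg.mul_prod hh
  have h1 : ∫ z, T.indicator (fun z : ℝ × ℝ => g z.1 * h z.2) z ∂(μ.prod μ)
      = ∫ x in Ioo 0 L, g x * ∫ t in (0 : ℝ)..x, h t := by
    rw [integral_prod _ (hint.indicator hT)]
    refine setIntegral_congr_fun measurableSet_Ioo fun x hx => ?_
    have : ∀ y, T.indicator (fun z : ℝ × ℝ => g z.1 * h z.2) (x, y)
        = (Iic x).indicator (fun y => g x * h y) y := by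
      intro y; simp [T, indicator]
    simp only [this]
    rw [integral_indicator measurableSet_Iic, hμ, Measure.restrict_restrict measurableSet_Iic,
      integral_const_mul, intervalIntegral.integral_of_le hx.1.le]
    congr 3
    ext y; simp only [mem_inter_iff, mem_Iic, mem_Ioo, mem_Ioc]
    exact ⟨fun ⟨a, b, _⟩ => ⟨b, a⟩, fun ⟨a, b⟩ => ⟨b, a, b.trans_lt hx.2⟩⟩
  have h2 : ∫ z, Tᶜ.indicator (fun z : ℝ × ℝ => g z.1 * h z.2) z ∂(μ.prod μ)
      = ∫ x in Ioo 0 L, (∫ t in (0 : ℝ)..x, g t) * h x := by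
    rw [integral_prod_symm _ (hint.indicator hT.compl)]
    refine setIntegral_congr_fun measurableSet_Ioo fun y hy => ?_
    have : ∀ x, Tᶜ.indicator (fun z : ℝ × ℝ => g z.1 * h z.2) (x, y)
        = (Iio y).indicator (fun x => g x * h y) x := by
      intro x; simp [T, indicator]
    simp only [this]
    rw [integral_indicator measurableSet_Iio, hμ, Measure.restrict_restrict measurableSet_Iio,
      integral_mul_const, intervalIntegral.integral_of_le hy.1.le, integral_Ioc_eq_integral_Ioo]
    congr 3
    ext x; simp only [mem_inter_iff, mem_Iio, mem_Ioo]
    exact ⟨fun ⟨a, b, _⟩ => ⟨b, a⟩, fun ⟨a, b⟩ => ⟨b, a, b.trans hy.2⟩⟩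
  have h3 : ∫ z, g z.1 * h z.2 ∂(μ.prod μ)
      = (∫ t in (0 : ℝ)..L, g t) * ∫ t in (0 : ℝ)..L, h t := by
    rw [integral_prod_mul, intervalIntegral.integral_of_le hL.le,
      intervalIntegral.integral_of_le hL.le, integral_Ioc_eq_integral_Ioo,
      integral_Ioc_eq_integral_Ioo]
  rw [← h1, ← h2, ← h3, ← integral_add (hint.indicator hT) (hint.indicator hT.compl)]
  refine integral_congr_ae (Eventually.of_forall fun z => ?_)
  exact indicator_self_add_compl_apply T _ z

lemma inner_eq_integral (f g : L2 L) : inner ℂ f g = ∫ x in Ioo 0 L, conj (f x) * g x := by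
  rw [L2.inner_def]
  refine integral_congr_ae (Eventually.of_forall fun x => ?_)
  simp only [RCLike.inner_apply]
  ring

/-- Integration by parts in `H¹(0, L)` for functions of which the first vanishes at `0`. -/
lemma inner_weakDeriv_add (hL : 0 < L) {f g : L2 L} (hf : f ∈ H1 L) (hg : g ∈ H1 L)
    (h0 : valueAt L f 0 = 0) :
    inner ℂ (weakDeriv L f) g + inner ℂ f (weakDeriv L g)
      = conj (valueAt L f L) * valueAt L g L := by
  have hLm : L ∈ Icc 0 L := ⟨hL.le, le_rfl⟩
  set f' := weakDeriv L f with hf'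
  set g' := weakDeriv L g with hg'
  have i1 : IntegrableOn (fun x => conj (f' x)) (Ioo 0 L) :=
    (Complex.conjCLE.toContinuousLinearMap.integrable_comp (integrableOn_L2 f'))
  have i2 : IntegrableOn g' (Ioo 0 L) := integrableOn_L2 g'
  have hconj : ∀ x, ∫ t in (0 : ℝ)..x, conj (f' t) = conj (∫ t in (0 : ℝ)..x, f' t) := by
    intro x
    rw [intervalIntegral, intervalIntegral, integral_conj, integral_conj, map_sub]
  have e1 : inner ℂ f g' = ∫ x in Ioo 0 L, (∫ t in (0 : ℝ)..x, conj (f' t)) * g' x := by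
    rw [inner_eq_integral]
    refine integral_congr_ae ?_
    filter_upwards [ae_eq_primitive_weakDeriv hL hf] with x hx
    rw [hx, h0, zero_add, hconj]
  have i3 : IntegrableOn (fun x => conj (f' x) * ∫ t in (0 : ℝ)..x, g' t) (Ioo 0 L) := by
    have hc := continuousOn_primitive hL i2 0
    obtain ⟨C, hC⟩ := isCompact_Icc.exists_bound_of_continuousOn hc
    simp only [zero_add] at hc hC
    exact Integrable.mul_bdd (c := C) i1
      ((hc.mono Ioo_subset_Icc_self).aestronglyMeasurable measurableSet_Ioo)
      ((ae_restrict_iff' measurableSet_Ioo).2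
        (Eventually.of_forall fun x hx => hC x (Ioo_subset_Icc_self hx)))
  have e2 : inner ℂ f' g = (∫ t in (0 : ℝ)..L, conj (f' t)) * valueAt L g 0
      + ∫ x in Ioo 0 L, conj (f' x) * ∫ t in (0 : ℝ)..x, g' t := by
    rw [inner_eq_integral, intervalIntegral.integral_of_le hL.le, integral_Ioc_eq_integral_Ioo,
      ← integral_mul_const, ← integral_add (i1.mul_const _) i3]
    refine integral_congr_ae ?_
    filter_upwards [ae_eq_primitive_weakDeriv hL hg] with x hx
    rw [hx, mul_add]
  rw [e1, e2, add_assoc, integral_mul_primitive_add hL i1 i2, valueAt_eq_primitive hL hf hLm, h0,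
    zero_add, valueAt_eq_primitive hL hg hLm, hconj]
  ring

/-- The Poincaré inequality. -/
lemma exists_poincare (hL : 0 < L) : ∃ C : ℝ, ∀ f ∈ H1 L, valueAt L f 0 = 0 →
    ‖f‖ ≤ C * ‖weakDeriv L f‖ := by
  set μ := volume.restrict (Ioo (0 : ℝ) L) with hμ
  set K : ℝ := (μ univ ^ (1 / (1 : ENNReal).toReal - 1 / (2 : ENNReal).toReal)).toReal with hK
  have hL1 : ∀ g : L2 L, ∫ x in Ioo 0 L, ‖g x‖ ≤ ‖g‖ * K := by
    intro g
    have h := eLpNorm_le_eLpNorm_mul_rpow_measure_univ (μ := μ) one_le_two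
      (Lp.aestronglyMeasurable g)
    have hfin : μ univ ^ (1 / (1 : ENNReal).toReal - 1 / (2 : ENNReal).toReal) ≠ ⊤ :=
      ENNReal.rpow_ne_top_of_nonneg (by norm_num) (measure_ne_top μ _)
    have h2 := ENNReal.toReal_mono (ENNReal.mul_ne_top (Lp.memLp g).eLpNorm_ne_top hfin) h
    rwa [ENNReal.toReal_mul, ← Lp.norm_def, eLpNorm_one_eq_lintegral_enorm,
      ← integral_norm_eq_lintegral_enorm (Lp.aestronglyMeasurable g)] at h2
  refine ⟨(measureUnivNNReal μ : ℝ) ^ (2 : ENNReal).toReal⁻¹ * K, fun f hf h0 => ?_⟩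
  have hb : ∀ᵐ x ∂μ, ‖f x‖ ≤ ‖weakDeriv L f‖ * K := by
    filter_upwards [ae_eq_primitive_weakDeriv hL hf, ae_restrict_mem measurableSet_Ioo] with x hx hx'
    rw [hx, h0, zero_add, intervalIntegral.integral_of_le hx'.1.le]
    refine (norm_integral_le_integral_norm _).trans (le_trans ?_ (hL1 _))
    exact setIntegral_mono_set (integrableOn_L2 _).norm
      (Eventually.of_forall fun x => norm_nonneg _)
      (LE.le.eventuallyLE fun t ht => ⟨ht.1, ht.2.trans_lt hx'.2⟩)
  refine (Lp.norm_le_of_ae_bound (by positivity) hb).trans_eq ?_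
  ring

end Sobolev

/-! ### The topology of the energy space -/

namespace EnergySpace

variable {p : Params}

lemma norm_sq_eq (U : EnergySpace p) : ‖U‖ ^ 2 =
    p.ρ * ‖U.Φ‖ ^ 2 + p.μ * ‖U.Θ‖ ^ 2 + p.α₁ * ‖U.Vx‖ ^ 2
      + p.β * ‖(p.γ : ℂ) • U.Vx - U.Px‖ ^ 2 + p.m₁ * ‖U.u‖ ^ 2 + p.m₂ * ‖U.η‖ ^ 2 := by
  have h : ((‖U‖ : ℂ)) ^ 2 = energyInner U U := (inner_self_eq_norm_sq_to_K (𝕜 := ℂ) U).symm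
  rw [energyInner_eq] at h
  simp only [inner_self_eq_norm_sq_to_K, Complex.coe_algebraMap] at h
  exact_mod_cast h

/-- A component whose weighted square is dominated by the energy depends continuously on the
state. -/
lemma norm_le_of_mul_sq_le {E : Type*} [NormedAddCommGroup E] {r : ℝ} (hr : 0 < r) {x : E}
    {N : ℝ} (hN : 0 ≤ N) (h : r * ‖x‖ ^ 2 ≤ N ^ 2) : ‖x‖ ≤ (√r)⁻¹ * N := by
  have hs := Real.sqrt_pos.2 hr
  rw [← div_eq_inv_mul, le_div_iff₀ hs]
  refine (sq_le_sq₀ (by positivity) hN).1 ?_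
  rw [mul_pow, Real.sq_sqrt hr.le]
  linarith

lemma energy_terms_nonneg (U : EnergySpace p) :
    0 ≤ p.ρ * ‖U.Φ‖ ^ 2 ∧ 0 ≤ p.μ * ‖U.Θ‖ ^ 2 ∧ 0 ≤ p.α₁ * ‖U.Vx‖ ^ 2 ∧
      0 ≤ p.β * ‖(p.γ : ℂ) • U.Vx - U.Px‖ ^ 2 ∧ 0 ≤ p.m₁ * ‖U.u‖ ^ 2 ∧ 0 ≤ p.m₂ * ‖U.η‖ ^ 2 := by
  have := p.ρ_pos; have := p.μ_pos; have := p.α₁_pos; have := p.β_pos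
  have := p.m₁_pos; have := p.m₂_pos
  refine ⟨?_, ?_, ?_, ?_, ?_, ?_⟩ <;> positivity

lemma norm_Vx_le (U : EnergySpace p) : ‖U.Vx‖ ≤ (√p.α₁)⁻¹ * ‖U‖ := by
  obtain ⟨_, _, _, _, _, _⟩ := energy_terms_nonneg U
  exact norm_le_of_mul_sq_le p.α₁_pos (norm_nonneg _) (by rw [norm_sq_eq]; linarith)

lemma norm_Px_le (U : EnergySpace p) : ‖U.Px‖ ≤ (|p.γ| * (√p.α₁)⁻¹ + (√p.β)⁻¹) * ‖U‖ := by
  obtain ⟨_, _, _, _, _, _⟩ := energy_terms_nonneg U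
  have h1 : ‖(p.γ : ℂ) • U.Vx - U.Px‖ ≤ (√p.β)⁻¹ * ‖U‖ :=
    norm_le_of_mul_sq_le p.β_pos (norm_nonneg _) (by rw [norm_sq_eq]; linarith)
  have h2 : ‖(p.γ : ℂ) • U.Vx‖ ≤ |p.γ| * ((√p.α₁)⁻¹ * ‖U‖) := by
    rw [norm_smul, Complex.norm_real, Real.norm_eq_abs]
    exact mul_le_mul_of_nonneg_left (norm_Vx_le U) (abs_nonneg _)
  have h3 : U.Px = (p.γ : ℂ) • U.Vx - ((p.γ : ℂ) • U.Vx - U.Px) := (sub_sub_cancel _ _).symm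
  rw [h3]
  refine (norm_sub_le _ _).trans ?_
  linarith

/-- `U ↦ V_x` -/
def VxCLM (p : Params) : EnergySpace p →L[ℂ] L2 p.L :=
  LinearMap.mkContinuous ⟨⟨Vx, Vx_add⟩, Vx_smul⟩ _ norm_Vx_le

/-- `U ↦ P_x` -/
def PxCLM (p : Params) : EnergySpace p →L[ℂ] L2 p.L :=
  LinearMap.mkContinuous ⟨⟨Px, Px_add⟩, Px_smul⟩ _ norm_Px_le

/-- `U ↦ Φ` -/
def ΦCLM (p : Params) : EnergySpace p →L[ℂ] L2 p.L :=
  LinearMap.mkContinuous ⟨⟨Φ, Φ_add⟩, Φ_smul⟩ (√p.ρ)⁻¹ fun U => by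
    obtain ⟨_, _, _, _, _, _⟩ := energy_terms_nonneg U
    exact norm_le_of_mul_sq_le p.ρ_pos (norm_nonneg _)
      (by rw [norm_sq_eq]; change p.ρ * ‖U.Φ‖ ^ 2 ≤ _; linarith)

/-- `U ↦ Θ` -/
def ΘCLM (p : Params) : EnergySpace p →L[ℂ] L2 p.L :=
  LinearMap.mkContinuous ⟨⟨Θ, Θ_add⟩, Θ_smul⟩ (√p.μ)⁻¹ fun U => by
    obtain ⟨_, _, _, _, _, _⟩ := energy_terms_nonneg U
    exact norm_le_of_mul_sq_le p.μ_pos (norm_nonneg _)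
      (by rw [norm_sq_eq]; change p.μ * ‖U.Θ‖ ^ 2 ≤ _; linarith)

/-- `U ↦ u` -/
def uCLM (p : Params) : EnergySpace p →L[ℂ] ℂ :=
  LinearMap.mkContinuous ⟨⟨u, u_add⟩, u_smul⟩ (√p.m₁)⁻¹ fun U => by
    obtain ⟨_, _, _, _, _, _⟩ := energy_terms_nonneg U
    exact norm_le_of_mul_sq_le p.m₁_pos (norm_nonneg _)
      (by rw [norm_sq_eq]; change p.m₁ * ‖U.u‖ ^ 2 ≤ _; linarith)

/-- `U ↦ η` -/
def ηCLM (p : Params) : EnergySpace p →L[ℂ] ℂ :=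
  LinearMap.mkContinuous ⟨⟨η, η_add⟩, η_smul⟩ (√p.m₂)⁻¹ fun U => by
    obtain ⟨_, _, _, _, _, _⟩ := energy_terms_nonneg U
    exact norm_le_of_mul_sq_le p.m₂_pos (norm_nonneg _)
      (by rw [norm_sq_eq]; change p.m₂ * ‖U.η‖ ^ 2 ≤ _; linarith)

/-- `V ∈ L²(0, L)` depends continuously on the state, by the Poincaré inequality. -/
lemma exists_V_clm (p : Params) :
    ∃ T : EnergySpace p →L[ℂ] L2 p.L, ∀ U : EnergySpace p, T U = U.V := by
  obtain ⟨C, hC⟩ := exists_poincare p.L_pos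
  have hb : ∀ U : EnergySpace p, ‖(U.V : L2 p.L)‖ ≤ |C| * (√p.α₁)⁻¹ * ‖U‖ := fun U =>
    calc ‖(U.V : L2 p.L)‖ ≤ C * ‖U.Vx‖ := hC _ U.V.2.1 U.V.2.2
      _ ≤ |C| * ‖U.Vx‖ := mul_le_mul_of_nonneg_right (le_abs_self C) (norm_nonneg _)
      _ ≤ |C| * ((√p.α₁)⁻¹ * ‖U‖) := mul_le_mul_of_nonneg_left (norm_Vx_le U) (abs_nonneg C)
      _ = _ := by ring
  exact ⟨LinearMap.mkContinuous ⟨⟨fun U => (U.V : L2 p.L), fun _ _ => rfl⟩, fun _ _ => rfl⟩ _ hb,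
    fun _ => rfl⟩

lemma exists_P_clm (p : Params) :
    ∃ T : EnergySpace p →L[ℂ] L2 p.L, ∀ U : EnergySpace p, T U = U.P := by
  obtain ⟨C, hC⟩ := exists_poincare p.L_pos
  have hb : ∀ U : EnergySpace p, ‖(U.P : L2 p.L)‖
      ≤ |C| * (|p.γ| * (√p.α₁)⁻¹ + (√p.β)⁻¹) * ‖U‖ := fun U =>
    calc ‖(U.P : L2 p.L)‖ ≤ C * ‖U.Px‖ := hC _ U.P.2.1 U.P.2.2
      _ ≤ |C| * ‖U.Px‖ := mul_le_mul_of_nonneg_right (le_abs_self C) (norm_nonneg _)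
      _ ≤ |C| * ((|p.γ| * (√p.α₁)⁻¹ + (√p.β)⁻¹) * ‖U‖) :=
        mul_le_mul_of_nonneg_left (norm_Px_le U) (abs_nonneg C)
      _ = _ := by ring
  exact ⟨LinearMap.mkContinuous ⟨⟨fun U => (U.P : L2 p.L), fun _ _ => rfl⟩, fun _ _ => rfl⟩ _ hb,
    fun _ => rfl⟩

/-- The energy space is complete: `(V_x, Φ, P_x, Θ, u, η)` are coordinates that identify it with
`L² × L² × L² × L² × ℂ × ℂ`. -/
instance : CompleteSpace (EnergySpace p) := by
  let T : EnergySpace p →L[ℂ] L2 p.L × L2 p.L × L2 p.L × L2 p.L × ℂ × ℂ :=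
    (VxCLM p).prod ((ΦCLM p).prod ((PxCLM p).prod ((ΘCLM p).prod ((uCLM p).prod (ηCLM p)))))
  have hT : ∀ U, T U = (U.Vx, U.Φ, U.Px, U.Θ, U.u, U.η) := fun _ => rfl
  have := p.ρ_pos; have := p.μ_pos; have := p.α₁_pos; have := p.β_pos
  have := p.m₁_pos; have := p.m₂_pos
  let K : ℝ≥0 := ⟨√(p.ρ + p.μ + p.α₁ + p.β * (|p.γ| + 1) ^ 2 + p.m₁ + p.m₂), Real.sqrt_nonneg _⟩
  have hanti : AntilipschitzWith K T := by
    refine AddMonoidHomClass.antilipschitz_of_bound T fun U => ?_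
    obtain ⟨N, hN⟩ : ∃ N, N = ‖T U‖ := ⟨_, rfl⟩
    have hNle := hN.ge
    rw [hT, Prod.norm_mk, Prod.norm_mk, Prod.norm_mk, Prod.norm_mk, Prod.norm_mk] at hNle
    simp only [max_le_iff] at hNle
    obtain ⟨h1, h2, h3, h4, h5, h6⟩ := hNle
    have hN0 : 0 ≤ N := (norm_nonneg _).trans h1
    have hγ : ‖(p.γ : ℂ) • U.Vx - U.Px‖ ≤ (|p.γ| + 1) * N := by
      refine (norm_sub_le _ _).trans ?_
      rw [norm_smul, Complex.norm_real, Real.norm_eq_abs]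
      linarith [mul_le_mul_of_nonneg_left h1 (abs_nonneg p.γ)]
    have hsq : ∀ {E : Type} [NormedAddCommGroup E] {x : E} {r M : ℝ}, 0 < r → ‖x‖ ≤ M →
        r * ‖x‖ ^ 2 ≤ r * M ^ 2 := fun hr h =>
      mul_le_mul_of_nonneg_left (pow_le_pow_left₀ (norm_nonneg _) h 2) hr.le
    rw [← hN]
    refine (sq_le_sq₀ (norm_nonneg _) (by positivity)).1 ?_
    change ‖U‖ ^ 2 ≤ (√(p.ρ + p.μ + p.α₁ + p.β * (|p.γ| + 1) ^ 2 + p.m₁ + p.m₂) * N) ^ 2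
    rw [mul_pow, Real.sq_sqrt (by positivity), norm_sq_eq]
    have e := hsq p.β_pos hγ
    rw [mul_pow] at e
    linarith [hsq p.ρ_pos h2, hsq p.μ_pos h4, hsq p.α₁_pos h1, hsq p.m₁_pos h5, hsq p.m₂_pos h6]
  have hsurj : Function.Surjective T := by
    rintro ⟨v, φ, q, θ, a, b⟩
    obtain ⟨V, hV, hVx, hV0⟩ := exists_primitive p.L_pos v 0
    obtain ⟨P, hP, hPx, hP0⟩ := exists_primitive p.L_pos q 0
    refine ⟨(⟨V, hV, hV0⟩, φ, ⟨P, hP, hP0⟩, θ, a, b), ?_⟩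
    exact Prod.ext hVx (Prod.ext rfl (Prod.ext hPx rfl))
  exact (completeSpace_congr (e := Equiv.ofBijective T ⟨hanti.injective, hsurj⟩)
    (hanti.isUniformEmbedding T.uniformContinuous)).2 inferInstance

end EnergySpace

open EnergySpace

/-! ### The generator of the beam -/

section Generator

variable {p : Params}

lemma generator_Φ (U : (generator p).domain) : (generator p U).Φ =
    ((p.α / p.ρ : ℝ) : ℂ) • U.1.Vxx - ((p.γ * p.β / p.ρ : ℝ) : ℂ) • U.1.Pxx := rfl

lemma generator_Θ (U : (generator p).domain) : (generator p U).Θ =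
    -((p.γ * p.β / p.μ : ℝ) : ℂ) • U.1.Vxx + ((p.β / p.μ : ℝ) : ℂ) • U.1.Pxx := rfl

lemma generator_u (U : (generator p).domain) : (generator p U).u =
    -((p.α / p.m₁ : ℝ) : ℂ) * valueAt p.L U.1.Vx p.L
      + ((p.γ * p.β / p.m₁ : ℝ) : ℂ) * valueAt p.L U.1.Px p.L
      - ((p.ξ₁ / p.m₁ : ℝ) : ℂ) * U.1.u := rfl

lemma generator_η (U : (generator p).domain) : (generator p U).η =
    ((p.γ * p.β / p.m₂ : ℝ) : ℂ) * valueAt p.L U.1.Vx p.L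
      - ((p.β / p.m₂ : ℝ) : ℂ) * valueAt p.L U.1.Px p.L
      - ((p.ξ₂ / p.m₂ : ℝ) : ℂ) * U.1.η := rfl

lemma mem_generator_domain {U : EnergySpace p} : U ∈ (generator p).domain ↔
    U.Φ ∈ H1star p ∧ U.Θ ∈ H1star p ∧ (U.V : L2 p.L) ∈ H2 p.L ∧ (U.P : L2 p.L) ∈ H2 p.L ∧
      valueAt p.L U.Φ p.L = U.u ∧ valueAt p.L U.Θ p.L = U.η := Iff.rfl

/-- `𝒜 U = W` amounts to `V_t = Φ`, `P_t = Θ`, the wave equations and the tip conditions, with the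
components of `W` in place of the time derivatives. -/
lemma generator_eq_iff (U : (generator p).domain) (W : EnergySpace p) : generator p U = W ↔
    (W.V : L2 p.L) = U.1.Φ ∧ (W.P : L2 p.L) = U.1.Θ ∧
      (p.ρ : ℂ) • W.Φ - (p.α : ℂ) • U.1.Vxx + ((p.γ * p.β : ℝ) : ℂ) • U.1.Pxx = 0 ∧
      (p.μ : ℂ) • W.Θ - (p.β : ℂ) • U.1.Pxx + ((p.γ * p.β : ℝ) : ℂ) • U.1.Vxx = 0 ∧
      (p.α : ℂ) * valueAt p.L U.1.Vx p.L - ((p.γ * p.β : ℝ) : ℂ) * valueAt p.L U.1.Px p.L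
        + (p.ξ₁ : ℂ) * U.1.u + (p.m₁ : ℂ) * W.u = 0 ∧
      (p.β : ℂ) * valueAt p.L U.1.Px p.L - ((p.γ * p.β : ℝ) : ℂ) * valueAt p.L U.1.Vx p.L
        + (p.ξ₂ : ℂ) * U.1.η + (p.m₂ : ℂ) * W.η = 0 := by
  have hρ : (p.ρ : ℂ) ≠ 0 := by exact_mod_cast p.ρ_pos.ne'
  have hμ : (p.μ : ℂ) ≠ 0 := by exact_mod_cast p.μ_pos.ne'
  have hm₁ : (p.m₁ : ℂ) ≠ 0 := by exact_mod_cast p.m₁_pos.ne'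
  have hm₂ : (p.m₂ : ℂ) ≠ 0 := by exact_mod_cast p.m₂_pos.ne'
  constructor
  · rintro rfl
    refine ⟨rfl, rfl, ?_, ?_, ?_, ?_⟩
    · rw [generator_Φ]; push_cast
      match_scalars <;> field_simp <;> ring
    · rw [generator_Θ]; push_cast
      match_scalars <;> field_simp <;> ring
    · rw [generator_u]; push_cast; field_simp; ring
    · rw [generator_η]; push_cast; field_simp; ring
  · rintro ⟨h1, h2, h3, h4, h5, h6⟩
    refine Prod.ext (Subtype.ext h1.symm) (Prod.ext ?_ (Prod.ext (Subtype.ext h2.symm)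
      (Prod.ext ?_ (Prod.ext ?_ ?_))))
    · have e : W.Φ = (p.ρ : ℂ)⁻¹ • ((p.α : ℂ) • U.1.Vxx - ((p.γ * p.β : ℝ) : ℂ) • U.1.Pxx) := by
        rw [eq_inv_smul_iff₀ hρ, ← sub_eq_zero, ← h3]; abel
      change (generator p U).Φ = W.Φ
      rw [generator_Φ, e]; push_cast
      match_scalars <;> field_simp
    · have e : W.Θ = (p.μ : ℂ)⁻¹ • ((p.β : ℂ) • U.1.Pxx - ((p.γ * p.β : ℝ) : ℂ) • U.1.Vxx) := by
        rw [eq_inv_smul_iff₀ hμ, ← sub_eq_zero, ← h4]; abel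
      change (generator p U).Θ = W.Θ
      rw [generator_Θ, e]; push_cast
      match_scalars <;> field_simp
    · change (generator p U).u = W.u
      rw [generator_u]
      refine mul_left_cancel₀ hm₁ ?_
      push_cast at h5 ⊢; field_simp; linear_combination -h5
    · change (generator p U).η = W.η
      rw [generator_η]
      refine mul_left_cancel₀ hm₂ ?_
      push_cast at h6 ⊢; field_simp; linear_combination -h6

/-- The energy identity: integrating by parts, all terms but the feedback at the tip cancel. -/
lemma re_inner_generator (U : (generator p).domain) :
    (inner ℂ (generator p U) (U : EnergySpace p)).re
      = -(p.ξ₁ * ‖U.1.u‖ ^ 2) - p.ξ₂ * ‖U.1.η‖ ^ 2 := by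
  obtain ⟨hΦ, hΘ, hV, hP, hu, hη⟩ := U.2
  obtain ⟨-, -, h3, h4, h5, h6⟩ := (generator_eq_iff U _).1 rfl
  have i1 := inner_weakDeriv_add p.L_pos hΦ.1 hV.2 hΦ.2
  have i2 := inner_weakDeriv_add p.L_pos hΦ.1 hP.2 hΦ.2
  have i3 := inner_weakDeriv_add p.L_pos hΘ.1 hV.2 hΘ.2
  have i4 := inner_weakDeriv_add p.L_pos hΘ.1 hP.2 hΘ.2
  rw [hu] at i1 i2
  rw [hη] at i3 i4
  have k1 : (p.ρ : ℂ) * inner ℂ U.1.Φ (generator p U).Φ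
      = (p.α : ℂ) * inner ℂ U.1.Φ U.1.Vxx - ((p.γ * p.β : ℝ) : ℂ) * inner ℂ U.1.Φ U.1.Pxx := by
    have := congrArg (inner ℂ U.1.Φ) h3
    simp only [inner_add_right, inner_sub_right, inner_smul_right, inner_zero_right] at this
    linear_combination this
  have k2 : (p.μ : ℂ) * inner ℂ U.1.Θ (generator p U).Θ
      = (p.β : ℂ) * inner ℂ U.1.Θ U.1.Pxx - ((p.γ * p.β : ℝ) : ℂ) * inner ℂ U.1.Θ U.1.Vxx := by
    have := congrArg (inner ℂ U.1.Θ) h4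
    simp only [inner_add_right, inner_sub_right, inner_smul_right, inner_zero_right] at this
    linear_combination this
  have k3 : (p.m₁ : ℂ) * inner ℂ U.1.u (generator p U).u = conj U.1.u *
      (-((p.α : ℂ) * valueAt p.L U.1.Vx p.L) + ((p.γ * p.β : ℝ) : ℂ) * valueAt p.L U.1.Px p.L
        - (p.ξ₁ : ℂ) * U.1.u) := by
    rw [RCLike.inner_apply]
    linear_combination conj U.1.u * h5
  have k4 : (p.m₂ : ℂ) * inner ℂ U.1.η (generator p U).η = conj U.1.η *
      (-((p.β : ℂ) * valueAt p.L U.1.Px p.L) + ((p.γ * p.β : ℝ) : ℂ) * valueAt p.L U.1.Vx p.L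
        - (p.ξ₂ : ℂ) * U.1.η) := by
    rw [RCLike.inner_apply]
    linear_combination conj U.1.η * h6
  set Φx := weakDeriv p.L U.1.Φ with hΦx
  set Θx := weakDeriv p.L U.1.Θ with hΘx
  have e1 : (generator p U).Vx = Φx := rfl
  have e2 : (generator p U).Px = Θx := rfl
  change inner ℂ Φx U.1.Vx + inner ℂ U.1.Φ U.1.Vxx = _ * valueAt p.L U.1.Vx p.L at i1
  change inner ℂ Φx U.1.Px + inner ℂ U.1.Φ U.1.Pxx = _ * valueAt p.L U.1.Px p.L at i2
  change inner ℂ Θx U.1.Vx + inner ℂ U.1.Θ U.1.Vxx = _ * valueAt p.L U.1.Vx p.L at i3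
  change inner ℂ Θx U.1.Px + inner ℂ U.1.Θ U.1.Pxx = _ * valueAt p.L U.1.Px p.L at i4
  have hnu : conj U.1.u * U.1.u = ((‖U.1.u‖ ^ 2 : ℝ) : ℂ) := by
    rw [Complex.conj_mul']; push_cast; rfl
  have hnη : conj U.1.η * U.1.η = ((‖U.1.η‖ ^ 2 : ℝ) : ℂ) := by
    rw [Complex.conj_mul']; push_cast; rfl
  -- `w` collects the elastic terms, which enter as `conj w - w`
  obtain ⟨w, hw⟩ : ∃ w : ℂ, w = (p.α : ℂ) * inner ℂ Φx U.1.Vx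
    - ((p.γ * p.β : ℝ) : ℂ) * inner ℂ Φx U.1.Px - ((p.γ * p.β : ℝ) : ℂ) * inner ℂ Θx U.1.Vx
    + (p.β : ℂ) * inner ℂ Θx U.1.Px := ⟨_, rfl⟩
  have hcw : conj w = (p.α : ℂ) * inner ℂ U.1.Vx Φx
    - ((p.γ * p.β : ℝ) : ℂ) * inner ℂ U.1.Px Φx - ((p.γ * p.β : ℝ) : ℂ) * inner ℂ U.1.Vx Θx
    + (p.β : ℂ) * inner ℂ U.1.Px Θx := by
    rw [hw]
    simp only [map_add, map_sub, map_mul, inner_conj_symm, Complex.conj_ofReal]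
  have key : inner ℂ (U : EnergySpace p) (generator p U)
      = conj w - w + ((-(p.ξ₁ * ‖U.1.u‖ ^ 2) - p.ξ₂ * ‖U.1.η‖ ^ 2 : ℝ) : ℂ) := by
    change energyInner (generator p U) (U : EnergySpace p) = _
    rw [energyInner_eq, k1, k2, k3, k4, e1, e2, hcw, hw]
    simp only [inner_sub_left, inner_sub_right, inner_smul_left, inner_smul_right,
      Complex.conj_ofReal]
    rw [Params.α] at *
    push_cast at hnu hnη ⊢
    linear_combination ((p.α₁ : ℂ) + p.γ ^ 2 * p.β) * i1 - p.γ * p.β * i2 - p.γ * p.β * i3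
      + p.β * i4 - p.ξ₁ * hnu - p.ξ₂ * hnη
  rw [← inner_conj_symm, Complex.conj_re, key, Complex.add_re, Complex.sub_re, Complex.conj_re,
    Complex.ofReal_re]
  ring

lemma generator_dissipative (U : (generator p).domain) :
    (inner ℂ (generator p U) (U : EnergySpace p)).re ≤ 0 := by
  have := p.ξ₁_pos; have := p.ξ₂_pos
  rw [re_inner_generator]
  have h1 : 0 ≤ p.ξ₁ * ‖U.1.u‖ ^ 2 := by positivity
  have h2 : 0 ≤ p.ξ₂ * ‖U.1.η‖ ^ 2 := by positivity
  linarith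

/-- `𝒜 U = F` is solved by integration: `Φ` and `Θ` are given, the equations determine `V_xx` and
`P_xx`, the tip conditions `V_x(L)` and `P_x(L)`. -/
lemma generator_surjective : Function.Surjective (generator p) := by
  intro F
  have hα₁ : (p.α₁ : ℂ) ≠ 0 := by exact_mod_cast p.α₁_pos.ne'
  have hβ : (p.β : ℂ) ≠ 0 := by exact_mod_cast p.β_pos.ne'
  -- the inverse of the matrix `(α, -γβ; -γβ, β)` is `(1, γ; γ, α/β) / α₁`
  let vxx : L2 p.L := ((p.ρ / p.α₁ : ℝ) : ℂ) • F.Φ + ((p.γ * p.μ / p.α₁ : ℝ) : ℂ) • F.Θ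
  let pxx : L2 p.L := ((p.μ / p.β : ℝ) : ℂ) • F.Θ + (p.γ : ℂ) • vxx
  let k₁ : ℂ := -(p.m₁ * F.u) - p.ξ₁ * valueAt p.L F.V p.L
  let k₂ : ℂ := -(p.m₂ * F.η) - p.ξ₂ * valueAt p.L F.P p.L
  let v : ℂ := (k₁ + p.γ * k₂) / p.α₁
  obtain ⟨vx, hvx, hvxx, hvL⟩ := exists_primitive_right p.L_pos vxx v
  obtain ⟨px, hpx, hpxx, hpL⟩ := exists_primitive_right p.L_pos pxx (k₂ / p.β + p.γ * v)
  obtain ⟨V, hV, hVx, hV0⟩ := exists_primitive p.L_pos vx 0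
  obtain ⟨P, hP, hPx, hP0⟩ := exists_primitive p.L_pos px 0
  let U : EnergySpace p := (⟨V, hV, hV0⟩, (F.V : L2 p.L), ⟨P, hP, hP0⟩, (F.P : L2 p.L),
    valueAt p.L F.V p.L, valueAt p.L F.P p.L)
  have hU : U ∈ (generator p).domain :=
    ⟨F.V.2, F.P.2, ⟨hV, by rw [show ((U.V : H1star p) : L2 p.L) = V from rfl, hVx]; exact hvx⟩,
      ⟨hP, by rw [show ((U.P : H1star p) : L2 p.L) = P from rfl, hPx]; exact hpx⟩, rfl, rfl⟩
  have e1 : U.Vx = vx := hVx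
  have e2 : U.Px = px := hPx
  have e3 : U.Vxx = vxx := by rw [Vxx, e1, hvxx]
  have e4 : U.Pxx = pxx := by rw [Pxx, e2, hpxx]
  refine ⟨⟨U, hU⟩, (generator_eq_iff _ _).2 ⟨rfl, rfl, ?_, ?_, ?_, ?_⟩⟩
  · simp only [e3, e4, vxx, pxx, Params.α]
    push_cast
    match_scalars <;> field_simp <;> ring
  · simp only [e3, e4, vxx, pxx]
    push_cast
    match_scalars <;> field_simp <;> ring
  · simp only [e1, e2, hvL, hpL, Params.α]
    change _ + (p.ξ₁ : ℂ) * valueAt p.L F.V p.L + _ = 0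
    simp only [v, k₁, k₂]
    push_cast
    field_simp
    ring
  · simp only [e1, e2, hvL, hpL]
    change _ + (p.ξ₂ : ℂ) * valueAt p.L F.P p.L + _ = 0
    simp only [v, k₁, k₂]
    push_cast
    field_simp
    ring

/-! ### The beam system and the Cauchy problem -/

/-- A continuous linear image of a curve has the image of its derivative. -/
lemma hasDerivWithinAt_clm {E F : Type*} [NormedAddCommGroup E] [NormedSpace ℂ E]
    [NormedAddCommGroup F] [NormedSpace ℂ F] (T : E →L[ℂ] F) {f : ℝ → E} {f' : E} {s : Set ℝ}
    {t : ℝ} (h : HasDerivWithinAt f f' s t) : HasDerivWithinAt (fun s => T (f s)) (T f') s t :=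
  (T.restrictScalars ℝ).hasFDerivAt.comp_hasDerivWithinAt t h

lemma isBeamSolution_iff (U₀ : EnergySpace p) (U : ℝ → EnergySpace p) :
    IsBeamSolution p U₀ U ↔ IsCauchySolution (generator p) U₀ U := by
  obtain ⟨TV, hTV⟩ := exists_V_clm p
  obtain ⟨TP, hTP⟩ := exists_P_clm p
  have dV : ∀ {D : EnergySpace p} {t : ℝ}, HasDerivWithinAt U D (Ici 0) t →
      HasDerivWithinAt (fun s => ((U s).V : L2 p.L)) (D.V : L2 p.L) (Ici 0) t := fun h => by
    have := hasDerivWithinAt_clm TV h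
    simp only [hTV] at this
    exact this
  have dP : ∀ {D : EnergySpace p} {t : ℝ}, HasDerivWithinAt U D (Ici 0) t →
      HasDerivWithinAt (fun s => ((U s).P : L2 p.L)) (D.P : L2 p.L) (Ici 0) t := fun h => by
    have := hasDerivWithinAt_clm TP h
    simp only [hTP] at this
    exact this
  constructor
  · intro h
    have hud : ∀ t : ℝ≥0, UniqueDiffWithinAt ℝ (Ici (0 : ℝ)) t := fun t =>
      uniqueDiffOn_Ici 0 _ t.coe_nonneg
    obtain ⟨hdiff, hcont⟩ := (contDiffOn_one_iff_derivWithin (uniqueDiffOn_Ici 0)).1 h.contDiffOn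
    have hd : ∀ t : ℝ≥0, HasDerivWithinAt U (derivWithin U (Ici 0) t) (Ici 0) t := fun t =>
      (hdiff _ t.coe_nonneg).hasDerivWithinAt
    have hVt : ∀ t : ℝ≥0, ((derivWithin U (Ici 0) t).V : L2 p.L) = (U t).Φ := fun t =>
      (hud t).eq_deriv _ (dV (hd t)) (h.V_t t)
    have hPt : ∀ t : ℝ≥0, ((derivWithin U (Ici 0) t).P : L2 p.L) = (U t).Θ := fun t =>
      (hud t).eq_deriv _ (dP (hd t)) (h.P_t t)
    have hmem : ∀ t : ℝ≥0, U t ∈ (generator p).domain := fun t =>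
      ⟨by rw [← hVt]; exact Subtype.property _, by rw [← hPt]; exact Subtype.property _,
        h.V_mem t, h.P_mem t, h.u_eq t, h.η_eq t⟩
    have hA : ∀ t : ℝ≥0, generator p ⟨U t, hmem t⟩ = derivWithin U (Ici 0) t := by
      intro t
      refine (generator_eq_iff _ _).2 ⟨hVt t, hPt t, ?_, ?_, ?_, ?_⟩
      · obtain ⟨d, hd1, hd2⟩ := h.wave_V t
        have e : (derivWithin U (Ici 0) t).Φ = d :=
          (hud t).eq_deriv _ (hasDerivWithinAt_clm (ΦCLM p) (hd t)) hd1
        rw [e]; exact hd2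
      · obtain ⟨d, hd1, hd2⟩ := h.wave_P t
        have e : (derivWithin U (Ici 0) t).Θ = d :=
          (hud t).eq_deriv _ (hasDerivWithinAt_clm (ΘCLM p) (hd t)) hd1
        rw [e]; exact hd2
      · obtain ⟨d, hd1, hd2⟩ := h.tip_V t
        have e : (derivWithin U (Ici 0) t).u = d :=
          (hud t).eq_deriv _ (hasDerivWithinAt_clm (uCLM p) (hd t)) hd1
        rw [e]; exact hd2
      · obtain ⟨d, hd1, hd2⟩ := h.tip_P t
        have e : (derivWithin U (Ici 0) t).η = d :=
          (hud t).eq_deriv _ (hasDerivWithinAt_clm (ηCLM p) (hd t)) hd1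
        rw [e]; exact hd2
    refine ⟨hmem, ?_, h.contDiffOn, fun t => by rw [hA]; exact hd t, h.init⟩
    simp only [hA]
    exact (hdiff.continuousOn.comp_continuous NNReal.continuous_coe fun t => t.coe_nonneg).prodMk
      (hcont.comp_continuous NNReal.continuous_coe fun t => t.coe_nonneg)
  · intro h
    have hm := fun t : ℝ≥0 => mem_generator_domain.1 (h.mem_domain t)
    have hA := fun t : ℝ≥0 => (generator_eq_iff ⟨U t, h.mem_domain t⟩ _).1 rfl
    exact
      { contDiffOn := h.contDiffOn
        V_mem := fun t => (hm t).2.2.1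
        P_mem := fun t => (hm t).2.2.2.1
        V_t := fun t => dV (h.hasDeriv t)
        P_t := fun t => dP (h.hasDeriv t)
        wave_V := fun t => ⟨_, hasDerivWithinAt_clm (ΦCLM p) (h.hasDeriv t), (hA t).2.2.1⟩
        wave_P := fun t => ⟨_, hasDerivWithinAt_clm (ΘCLM p) (h.hasDeriv t), (hA t).2.2.2.1⟩
        left_V := fun t => (U t).V.2.2
        left_P := fun t => (U t).P.2.2
        u_eq := fun t => (hm t).2.2.2.2.1
        η_eq := fun t => (hm t).2.2.2.2.2
        tip_V := fun t => ⟨_, hasDerivWithinAt_clm (uCLM p) (h.hasDeriv t), (hA t).2.2.2.2.1⟩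
        tip_P := fun t => ⟨_, hasDerivWithinAt_clm (ηCLM p) (h.hasDeriv t), (hA t).2.2.2.2.2⟩
        init := h.init }

end Generator

end PiezoBeam

end

theorem theorem2p1 (p : PiezoBeam.Params) :
    -- the beam system is equivalent to the Cauchy problem `U_t = 𝒜 U`, `U(0) = U₀`
    (∀ (U₀ : PiezoBeam.EnergySpace p) (U : ℝ → PiezoBeam.EnergySpace p),
      PiezoBeam.IsBeamSolution p U₀ U ↔
        PiezoBeam.IsCauchySolution (PiezoBeam.generator p) U₀ U) ∧
    -- `𝒜` generates a contraction semigroup `S`, and `S(t) U₀` is the unique solution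
    ∃ S : NNReal → PiezoBeam.EnergySpace p →L[ℂ] PiezoBeam.EnergySpace p,
      PiezoBeam.IsContractionSemigroup S ∧
      PiezoBeam.IsGeneratorOf (PiezoBeam.generator p) S ∧
      ∀ U₀ ∈ (PiezoBeam.generator p).domain,
        PiezoBeam.IsCauchySolution (PiezoBeam.generator p) U₀ (fun t => S t.toNNReal U₀) ∧
        ∀ U : ℝ → PiezoBeam.EnergySpace p,
          PiezoBeam.IsCauchySolution (PiezoBeam.generator p) U₀ U →
            ∀ t : NNReal, U t = S t U₀ := by
  obtain ⟨S, hS, hgen, hsol⟩ := PiezoBeam.exists_semigroup_of_dissipative_surjective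
    PiezoBeam.generator_dissipative (PiezoBeam.generator_surjective (p := p))
  exact ⟨PiezoBeam.isBeamSolution_iff, S, hS, hgen, fun U₀ hU₀ => ⟨hsol U₀ hU₀, fun U hU t => by
    rw [hU.unique PiezoBeam.generator_dissipative (hsol U₀ hU₀) t, Real.toNNReal_coe]⟩⟩
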